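/- Let $X$ be a nonempty $\mathrm{CAT}(0)$ space. A \emph{flat} in $X$ is the image of an isometric embedding $\mathbb{E}^k\to X$ of a Euclidean space of some dimension $k\ge 2$. Say that $X$ has \emph{isolated flats} if there is a set $\mathcal F$ of flats in $X$ such that (1) there is a constant $B$ such that every flat in $X$ lies in the $B$-neighborhood of some $F'\in\mathcal F$; (2) there is a function $\psi\colon[0,\infty)\to[0,\infty)$ such that for all distinct $F_1,F_2\in\mathcal F$ and all $k\ge 0$ the intersection of the $k$-neighborhoods of $F_1$ and $F_2$ has diameter at most $\psi(k)$; (3) $\mathcal F$ is invariant under every isometry of $X$ onto itself. A group action on a metric space is \emph{geometric} if it is isometric, properly discontinuous and cocompact, and a group is \emph{word hyperbolic} if it admits a geometric action on a nonempty $\delta$-hyperbolic geodesic metric space for some $\delta$ (that is, one in which each side of every geodesic triangle lies in the $\delta$-neighborhood of the union of the other two sides). \textbf{Theorem.} If a group $G$ acts geometrically on a nonempty $\mathrm{CAT}(0)$ space $X$ with isolated flats, then either $G$ is word hyperbolic or $G$ contains a subgroup isomorphic to $\mathbb{Z}\times\mathbb{Z}$. -/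

import Mathlib

/-- `γ` restricted to `[0, dist x y]` is a geodesic segment from `x` to `y`, i.e. an isometric
embedding of the interval `[0, dist x y]` starting at `x` and ending at `y`. -/
structure IsGeodesicSegment {X : Type*} [MetricSpace X] (γ : ℝ → X) (x y : X) : Prop where
  source : γ 0 = x
  target : γ (dist x y) = y
  isometric : ∀ s ∈ Set.Icc 0 (dist x y), ∀ t ∈ Set.Icc 0 (dist x y), dist (γ s) (γ t) = |s - t|

/-- Every pair of points is connected by a geodesic. -/
def IsGeodesicSpace (X : Type*) [MetricSpace X] : Prop :=
  ∀ x y : X, ∃ γ : ℝ → X, IsGeodesicSegment γ x y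

/-- A `CAT(0)` space: a geodesic space in which distances between points of a geodesic triangle
are at most the distances between the corresponding points of a comparison triangle in the
Euclidean plane. As any two sides of a triangle share a vertex and the labelling of the vertices
is arbitrary, it is enough to compare a point `α s` of a side `[p, q]` with a point `β t` of a
side `[p, r]`; two points of the same side are always at the same distance as the corresponding
points. -/
structure IsCAT0 (X : Type*) [MetricSpace X] : Prop where
  geodesic : IsGeodesicSpace X
  comparison : ∀ (p q r : X) (α β : ℝ → X), IsGeodesicSegment α p q → IsGeodesicSegment β p r →
    ∀ p' q' r' : EuclideanSpace ℝ (Fin 2),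
      dist p' q' = dist p q → dist p' r' = dist p r → dist q' r' = dist q r →
      ∀ s ∈ Set.Icc 0 (dist p q), ∀ t ∈ Set.Icc 0 (dist p r),
      ∀ x' ∈ segment ℝ p' q', ∀ y' ∈ segment ℝ p' r', dist p' x' = s → dist p' y' = t →
        dist (α s) (β t) ≤ dist x' y'

/-- A flat: the image of an isometric embedding of a Euclidean space of dimension `k ≥ 2`. -/
def IsFlat {X : Type*} [MetricSpace X] (F : Set X) : Prop :=
  ∃ k : ℕ, 2 ≤ k ∧ ∃ f : EuclideanSpace ℝ (Fin k) → X, Isometry f ∧ Set.range f = F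

/-- `X` has isolated flats: there is a family `𝓕` of flats which is maximal, isolated and
equivariant. -/
def HasIsolatedFlats (X : Type*) [MetricSpace X] : Prop :=
  ∃ 𝓕 : Set (Set X), (∀ F ∈ 𝓕, IsFlat F) ∧
    (∃ B : ℝ, ∀ F : Set X, IsFlat F → ∃ F' ∈ 𝓕, F ⊆ Metric.thickening B F') ∧
    (∃ ψ : NNReal → NNReal, ∀ F₁ ∈ 𝓕, ∀ F₂ ∈ 𝓕, F₁ ≠ F₂ → ∀ k : NNReal,
      Metric.ediam (Metric.thickening (k : ℝ) F₁ ∩ Metric.thickening (k : ℝ) F₂) ≤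
        (ψ k : ENNReal)) ∧
    (∀ φ : X ≃ᵢ X, ∀ F ∈ 𝓕, φ '' F ∈ 𝓕)

/-- A geometric action: isometric, properly discontinuous and cocompact. -/
structure IsGeometricAction (G X : Type*) [Group G] [MetricSpace X] [MulAction G X] : Prop where
  isometric : ∀ g : G, Isometry (fun x : X => g • x)
  properlyDiscontinuous : ProperlyDiscontinuousSMul G X
  cocompact : ∃ K : Set X, IsCompact K ∧ ∀ x : X, ∃ g : G, ∃ y ∈ K, g • y = x

/-- A `δ`-hyperbolic space (for some `δ`): a geodesic space in which each side of every geodesic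
triangle lies in the `δ`-neighbourhood of the union of the other two sides. -/
def IsHyperbolicSpace (Y : Type*) [MetricSpace Y] : Prop :=
  IsGeodesicSpace Y ∧ ∃ δ : ℝ, ∀ (p q r : Y) (α β γ : ℝ → Y),
    IsGeodesicSegment α p q → IsGeodesicSegment β q r → IsGeodesicSegment γ r p →
    ∀ x ∈ α '' Set.Icc 0 (dist p q),
      ∃ y ∈ β '' Set.Icc 0 (dist q r) ∪ γ '' Set.Icc 0 (dist r p), dist x y ≤ δ

/-- A group is word hyperbolic if it admits a geometric action on a (nonempty) `δ`-hyperbolic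
space. Such a space is proper, hence has at most the cardinality of the continuum, so that
nothing is lost by taking it in the lowest universe. -/
def IsWordHyperbolic (G : Type*) [Group G] : Prop :=
  ∃ (Y : Type) (_ : MetricSpace Y) (_ : MulAction G Y),
    Nonempty Y ∧ IsHyperbolicSpace Y ∧ IsGeometricAction G Y

/-! ### Geodesic segments, comparison triangles and the CAT(0) inequality -/

namespace IsGeodesicSegment

variable {X : Type*} [MetricSpace X] {γ : ℝ → X} {x y : X}

/-! A geometric action makes `X` proper. If `X` is hyperbolic, the given action already shows that
`G` is word hyperbolic. Otherwise the flat plane theorem (`exists_isFlat`) produces a flat, so the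
isolated family is nonempty. Isolation makes the family locally finite (`finite_flats_inter`), so
the stabiliser of a member acts cocompactly on it (`exists_isCompact_stabilizer`). Bieberbach's
argument (`linear_eq_one`) then provides two independent translations, and these yield a copy of `ℤ
× ℤ`.

The flat plane theorem rests on rigidity: along a CAT(0) geodesic the squared distance to a point,
minus the squared arc length, is convex, so an affine upper bound attained at an interior point is
attained everywhere (`dist_sq_eq_of_touch`). Fat triangles supply long geodesics along which the
distance to a remote point is almost affine, with slope bounded away from `±1`. In the limit, CAT(0)
comparison bounds the distances between a line and a ray from above by Euclidean ones, with equality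
at the common origin; rigidity makes them all equal. Midpoints between line and ray fill in a flat
half plane, and recentring ever deeper inside it gives a plane.

The Bieberbach part is an extremal argument: a nontrivial but small rotation part would allow
commutators to produce ever shorter elements of a kind for which discreteness guarantees a shortest
one. -/

theorem dist_source (h : IsGeodesicSegment γ x y) {t : ℝ} (ht : t ∈ Set.Icc 0 (dist x y)) :
    dist x (γ t) = t := by
  have := h.isometric 0 ⟨le_rfl, dist_nonneg⟩ t ht
  rw [h.source] at this
  rw [this, zero_sub, abs_neg, abs_of_nonneg ht.1]

theorem dist_target (h : IsGeodesicSegment γ x y) {t : ℝ} (ht : t ∈ Set.Icc 0 (dist x y)) :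
    dist (γ t) y = dist x y - t := by
  have := h.isometric t ht _ ⟨dist_nonneg, le_rfl⟩
  rw [h.target] at this
  rw [this, abs_sub_comm, abs_of_nonneg (by linarith [ht.2])]

theorem initial (h : IsGeodesicSegment γ x y) {t : ℝ} (ht : t ∈ Set.Icc 0 (dist x y)) :
    IsGeodesicSegment γ x (γ t) := by
  have e := h.dist_source ht
  refine ⟨h.source, by rw [e], fun s hs r hr => ?_⟩
  rw [e] at hs hr
  exact h.isometric s ⟨hs.1, hs.2.trans ht.2⟩ r ⟨hr.1, hr.2.trans ht.2⟩

theorem reverse (h : IsGeodesicSegment γ x y) :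
    IsGeodesicSegment (fun t => γ (dist x y - t)) y x := by
  refine ⟨by simp [h.target], by simp [dist_comm y x, h.source], fun s hs t ht => ?_⟩
  rw [dist_comm y x] at hs ht
  rw [h.isometric _ ⟨by linarith [hs.2], by linarith [hs.1]⟩ _
    ⟨by linarith [ht.2], by linarith [ht.1]⟩, abs_sub_comm]
  ring_nf

end IsGeodesicSegment

/-- A path which is isometric on `[u, v]`, reparametrised to start at time `0`. -/
theorem isGeodesicSegment_of_isometric {X : Type*} [MetricSpace X] {c : ℝ → X} {u v : ℝ}
    (huv : u ≤ v) (hc : ∀ s ∈ Set.Icc u v, ∀ t ∈ Set.Icc u v, dist (c s) (c t) = |s - t|) :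
    dist (c u) (c v) = v - u ∧ IsGeodesicSegment (fun t => c (u + t)) (c u) (c v) := by
  have e : dist (c u) (c v) = v - u := by
    rw [hc u ⟨le_rfl, huv⟩ v ⟨huv, le_rfl⟩, abs_sub_comm, abs_of_nonneg (by linarith)]
  refine ⟨e, by simp, by rw [e]; simp, fun s hs t ht => ?_⟩
  rw [e] at hs ht
  rw [hc _ ⟨by linarith [hs.1], by linarith [hs.2]⟩ _ ⟨by linarith [ht.1], by linarith [ht.2]⟩]
  simp

/-- As `isGeodesicSegment_of_isometric`, run backwards. -/
theorem isGeodesicSegment_of_isometric_neg {X : Type*} [MetricSpace X] {c : ℝ → X} {u v : ℝ}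
    (huv : u ≤ v) (hc : ∀ s ∈ Set.Icc u v, ∀ t ∈ Set.Icc u v, dist (c s) (c t) = |s - t|) :
    IsGeodesicSegment (fun t => c (v - t)) (c v) (c u) := by
  obtain ⟨e, h⟩ := isGeodesicSegment_of_isometric huv hc
  have := h.reverse
  simp only [e] at this
  convert this using 3
  ring

/-- Comparison triangles exist. -/
theorem exists_comparison_triangle {X : Type*} [MetricSpace X] (p q r : X) :
    ∃ p' q' r' : EuclideanSpace ℝ (Fin 2),
      dist p' q' = dist p q ∧ dist p' r' = dist p r ∧ dist q' r' = dist q r := by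
  set A := dist p q with hA
  set B := dist p r with hB
  set C := dist q r with hC
  have hA0 : 0 ≤ A := dist_nonneg
  have hB0 : 0 ≤ B := dist_nonneg
  have hC0 : 0 ≤ C := dist_nonneg
  have h1 : C ≤ A + B := by
    have := dist_triangle q p r; rwa [dist_comm q p] at this
  have h2 : A ≤ B + C := by
    have := dist_triangle p r q; rwa [dist_comm r q] at this
  have h3 : B ≤ A + C := dist_triangle p q r
  rcases hA0.eq_or_lt with h0 | h0
  · refine ⟨0, 0, !₂[B, 0], ?_, ?_, ?_⟩
    · simp [← h0]
    · rw [EuclideanSpace.dist_eq]; simp [Real.sqrt_sq hB0]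
    · rw [EuclideanSpace.dist_eq]; simp [Real.sqrt_sq hB0]; linarith
  -- With the first side on the horizontal axis, the law of cosines dictates the abscissa `x` of the
  -- third vertex.
  · set x := (A ^ 2 + B ^ 2 - C ^ 2) / (2 * A) with hx
    have hxA : 2 * A * x = A ^ 2 + B ^ 2 - C ^ 2 := by rw [hx]; field_simp
    have hxB : x ^ 2 ≤ B ^ 2 := by
      apply sq_le_sq'
      · rw [hx, le_div_iff₀ (by positivity)]; nlinarith
      · rw [hx, div_le_iff₀ (by positivity)]; nlinarith
    refine ⟨0, !₂[A, 0], !₂[x, √(B ^ 2 - x ^ 2)], ?_, ?_, ?_⟩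
    · rw [EuclideanSpace.dist_eq]; simp [Real.sqrt_sq hA0]
    · rw [EuclideanSpace.dist_eq]; simp [Real.sq_sqrt (sub_nonneg.2 hxB), Real.sqrt_sq hB0]
    · rw [EuclideanSpace.dist_eq]
      simp only [Real.dist_eq, Fin.sum_univ_two, sq_abs]
      simp only [Matrix.cons_val_zero, Matrix.cons_val_one, zero_sub, neg_sq,
        Real.sq_sqrt (sub_nonneg.2 hxB), Matrix.cons_val_fin_one]
      rw [Real.sqrt_eq_iff_mul_self_eq (by nlinarith) hC0]
      nlinarith

namespace IsCAT0

variable {X : Type*} [MetricSpace X]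

/-- The comparison inequality in terms of the side lengths. -/
theorem dist_sq_le (hX : IsCAT0 X) {p q r : X} {α β : ℝ → X} (hα : IsGeodesicSegment α p q)
    (hβ : IsGeodesicSegment β p r) {l m : ℝ} (hl : l ∈ Set.Icc (0 : ℝ) 1)
    (hm : m ∈ Set.Icc (0 : ℝ) 1) :
    dist (α (l * dist p q)) (β (m * dist p r)) ^ 2 ≤ l ^ 2 * dist p q ^ 2 + m ^ 2 * dist p r ^ 2
      - l * m * (dist p q ^ 2 + dist p r ^ 2 - dist q r ^ 2) := by
  obtain ⟨p', q', r', h1, h2, h3⟩ := exists_comparison_triangle p q r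
  have hpq : (0 : ℝ) ≤ dist p q := dist_nonneg
  have hpr : (0 : ℝ) ≤ dist p r := dist_nonneg
  have key := hX.comparison p q r α β hα hβ p' q' r' h1 h2 h3 (l * dist p q)
    ⟨mul_nonneg hl.1 hpq, mul_le_of_le_one_left hpq hl.2⟩ (m * dist p r)
    ⟨mul_nonneg hm.1 hpr, mul_le_of_le_one_left hpr hm.2⟩ (p' + l • (q' - p'))
    (by rw [segment_eq_image']; exact ⟨l, hl, rfl⟩) (p' + m • (r' - p'))
    (by rw [segment_eq_image']; exact ⟨m, hm, rfl⟩)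
    (by rw [dist_self_add_right, norm_smul, Real.norm_of_nonneg hl.1, ← dist_eq_norm, dist_comm q',
      h1])
    (by rw [dist_self_add_right, norm_smul, Real.norm_of_nonneg hm.1, ← dist_eq_norm, dist_comm r',
      h2])
  refine (pow_le_pow_left₀ dist_nonneg key 2).trans (le_of_eq ?_)
  have e3 : dist q r = ‖(q' - p') - (r' - p')‖ := by
    rw [← h3, ← dist_sub_right q' r' p', dist_eq_norm]
  have e1 : dist p q = ‖q' - p'‖ := by rw [← h1, dist_comm, dist_eq_norm]
  have e2 : dist p r = ‖r' - p'‖ := by rw [← h2, dist_comm, dist_eq_norm]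
  rw [dist_add_left, dist_eq_norm, e1, e2, e3, norm_sub_sq_real, norm_sub_sq_real (q' - p'),
    real_inner_smul_left, real_inner_smul_right, norm_smul, norm_smul,
    Real.norm_of_nonneg hl.1, Real.norm_of_nonneg hm.1]
  ring

/-- The last quotient is twice the cosine of the comparison angle at `p`, so an angle measured on
long sides controls distances near `p`. -/
theorem dist_sq_le_of_mem (hX : IsCAT0 X) {p q r : X} {α β : ℝ → X}
    (hα : IsGeodesicSegment α p q) (hβ : IsGeodesicSegment β p r) {s t : ℝ}
    (hs : s ∈ Set.Icc 0 (dist p q)) (ht : t ∈ Set.Icc 0 (dist p r)) (hq : 0 < dist p q)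
    (hr : 0 < dist p r) :
    dist (α s) (β t) ^ 2 ≤ s ^ 2 + t ^ 2
      - s * t * ((dist p q ^ 2 + dist p r ^ 2 - dist q r ^ 2) / (dist p q * dist p r)) := by
  have := hX.dist_sq_le hα hβ (l := s / dist p q) (m := t / dist p r)
    ⟨div_nonneg hs.1 hq.le, div_le_one_of_le₀ hs.2 hq.le⟩
    ⟨div_nonneg ht.1 hr.le, div_le_one_of_le₀ ht.2 hr.le⟩
  rw [div_mul_cancel₀ _ hq.ne', div_mul_cancel₀ _ hr.ne'] at this
  refine this.trans (le_of_eq ?_)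
  field_simp

/-- The Bruhat-Tits inequality. -/
theorem dist_sq_le_segment (hX : IsCAT0 X) {x y : X} {γ : ℝ → X} (hγ : IsGeodesicSegment γ x y)
    (z : X) {l : ℝ} (hl : l ∈ Set.Icc (0 : ℝ) 1) :
    dist z (γ (l * dist x y)) ^ 2 ≤ (1 - l) * dist z x ^ 2 + l * dist z y ^ 2
      - l * (1 - l) * dist x y ^ 2 := by
  obtain ⟨β, hβ⟩ := hX.geodesic x z
  have := hX.dist_sq_le hγ hβ hl (m := 1) ⟨zero_le_one, le_rfl⟩
  rw [one_mul, hβ.target, dist_comm _ z] at this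
  rw [dist_comm z x, dist_comm z y]
  linarith

/-- The Bruhat-Tits inequality along a path which is isometric on `[u, v]`. -/
theorem dist_sq_le_path (hX : IsCAT0 X) {c : ℝ → X} {u v r : ℝ} (hu : u ≤ r) (hv : r ≤ v)
    (hc : ∀ s ∈ Set.Icc u v, ∀ t ∈ Set.Icc u v, dist (c s) (c t) = |s - t|) (z : X) :
    (v - u) * dist z (c r) ^ 2 ≤ (v - r) * dist z (c u) ^ 2 + (r - u) * dist z (c v) ^ 2
      - (r - u) * (v - r) * (v - u) := by
  rcases (hu.trans hv).eq_or_lt with h | h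
  · have h1 : r = u := by linarith
    have h2 : r = v := by linarith
    subst h1; subst h2; simp
  obtain ⟨e, hs⟩ := isGeodesicSegment_of_isometric h.le hc
  have hvu : 0 < v - u := sub_pos.2 h
  have := hX.dist_sq_le_segment hs z (l := (r - u) / (v - u))
    ⟨div_nonneg (by linarith) hvu.le, div_le_one_of_le₀ (by linarith) hvu.le⟩
  rw [e, div_mul_cancel₀ _ hvu.ne', add_sub_cancel] at this
  have := mul_le_mul_of_nonneg_left this hvu.le
  refine this.trans (le_of_eq ?_)
  field_simp
  ring

/-- A quadratic upper bound for the squared distance to the points of a path which is attained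
inside `[u, v]` is attained at the end points. -/
theorem dist_sq_eq_of_touch (hX : IsCAT0 X) {c : ℝ → X} {u v r m n : ℝ} (hu : u < r) (hv : r < v)
    (hc : ∀ s ∈ Set.Icc u v, ∀ t ∈ Set.Icc u v, dist (c s) (c t) = |s - t|) (z : X)
    (h1 : dist z (c u) ^ 2 ≤ u ^ 2 + m * u + n) (h2 : dist z (c v) ^ 2 ≤ v ^ 2 + m * v + n)
    (h3 : dist z (c r) ^ 2 = r ^ 2 + m * r + n) :
    dist z (c u) ^ 2 = u ^ 2 + m * u + n ∧ dist z (c v) ^ 2 = v ^ 2 + m * v + n := by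
  have key := hX.dist_sq_le_path hu.le hv.le hc z
  rw [h3] at key
  have a1 : 0 < v - r := sub_pos.2 hv
  have a2 : 0 < r - u := sub_pos.2 hu
  constructor
  · refine le_antisymm h1 (le_of_mul_le_mul_left (a := v - r) ?_ a1)
    have := mul_le_mul_of_nonneg_left h2 a2.le
    linarith
  · refine le_antisymm h2 (le_of_mul_le_mul_left (a := r - u) ?_ a2)
    have := mul_le_mul_of_nonneg_left h1 a1.le
    linarith

/-- A convex function on the line lying below an affine one and meeting it once coincides with it.
This is the rigidity that turns comparison inequalities into flatness. -/
theorem dist_sq_eq_of_touch_line (hX : IsCAT0 X) {c : ℝ → X} (hc : Isometry c) (z : X)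
    {m n r₀ : ℝ} (h : ∀ r, dist z (c r) ^ 2 ≤ r ^ 2 + m * r + n)
    (h0 : dist z (c r₀) ^ 2 = r₀ ^ 2 + m * r₀ + n) (r : ℝ) :
    dist z (c r) ^ 2 = r ^ 2 + m * r + n := by
  have hc' : ∀ u v : ℝ, ∀ s ∈ Set.Icc u v, ∀ t ∈ Set.Icc u v, dist (c s) (c t) = |s - t| :=
    fun u v s _ t _ => by rw [hc.dist_eq, Real.dist_eq]
  rcases lt_trichotomy r r₀ with hr | hr | hr
  · exact (hX.dist_sq_eq_of_touch hr (lt_add_one r₀) (hc' _ _) z (h _) (h _) h0).1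
  · rw [hr, h0]
  · exact (hX.dist_sq_eq_of_touch (sub_one_lt r₀) hr (hc' _ _) z (h _) (h _) h0).2

/-- Moving a distance `1` along the geodesics issuing from `x` does not increase distances. -/
theorem dist_unit_le (hX : IsCAT0 X) {x u v : X} {α β : ℝ → X} (hα : IsGeodesicSegment α x u)
    (hβ : IsGeodesicSegment β x v) (hu : 1 ≤ dist x u) (hv : 1 ≤ dist x v) :
    dist (α 1) (β 1) ≤ dist u v := by
  have := hX.dist_sq_le_of_mem hα hβ (s := 1) (t := 1) ⟨zero_le_one, hu⟩ ⟨zero_le_one, hv⟩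
    (by linarith) (by linarith)
  refine le_of_sq_le_sq (this.trans ?_) dist_nonneg
  have h1 : 1 ≤ dist x u * dist x v := by nlinarith
  have h2 : (0 : ℝ) < dist x u * dist x v := by linarith
  have h3 : 2 - dist u v ^ 2 ≤
      (dist x u ^ 2 + dist x v ^ 2 - dist u v ^ 2) / (dist x u * dist x v) := by
    rw [le_div_iff₀ h2]
    nlinarith [sq_nonneg (dist x u - dist x v), sq_nonneg (dist u v)]
  linarith

end IsCAT0

/-! ### Geometric actions: properness and limits -/

open Filter Topology

section Proper

variable {G X : Type*} [Group G] [MetricSpace X] [MulAction G X]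

namespace IsGeometricAction

theorem isIsometricSMul (hG : IsGeometricAction G X) : IsIsometricSMul G X := ⟨hG.isometric⟩

theorem finite_smul_inter (hG : IsGeometricAction G X) {K L : Set X} (hK : IsCompact K)
    (hL : IsCompact L) : {g : G | ∃ x ∈ K, g • x ∈ L}.Finite := by
  refine (hG.properlyDiscontinuous.finite_disjoint_inter_image hK hL).subset ?_
  rintro g ⟨x, hx, hgx⟩
  exact ⟨g • x, ⟨x, hx, rfl⟩, hgx⟩

/-- Proper discontinuity with respect to compact sets and cocompactness force local
compactness. -/
theorem exists_isCompact_mem_nhds (hG : IsGeometricAction G X) (x : X) :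
    ∃ L ∈ 𝓝 x, IsCompact L := by
  have := hG.isIsometricSMul
  obtain ⟨K, hK, hcov⟩ := hG.cocompact
  have hfin : {g : G | x ∈ (fun y => g • y) '' K}.Finite := by
    refine (hG.finite_smul_inter hK (isCompact_singleton (x := x))).subset ?_
    rintro g ⟨y, hy, hgy⟩
    exact ⟨y, hy, hgy⟩
  have hc : ∀ g : G, IsCompact ((fun y => g • y) '' K) :=
    fun g => hK.image (hG.isometric g).continuous
  refine ⟨⋃ g ∈ {g : G | x ∈ (fun y => g • y) '' K}, (fun y => g • y) '' K, ?_,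
    hfin.isCompact_biUnion fun g _ => hc g⟩
  by_contra hn
  have hfr : ∃ᶠ y in 𝓝 x,
      y ∉ ⋃ g ∈ {g : G | x ∈ (fun y => g • y) '' K}, (fun y => g • y) '' K := not_eventually.1 hn
  obtain ⟨u, hu, hun⟩ := exists_seq_forall_of_frequently hfr
  -- A sequence outside the union converging to `x` forms, with its limit, a compact set. So
  -- finitely many translates of `K` cover it, one of them infinitely often; being closed, that one
  -- contains `x`, hence belongs to the union.
  have hfin2 := hG.finite_smul_inter hK hu.isCompact_insert_range
  have hex : ∀ n, ∃ g : G, ∃ y ∈ K, g • y = u n := fun n => hcov (u n)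
  choose g y hy hgy using hex
  have hmem : ∀ n, g n ∈ {g : G | ∃ z ∈ K, g • z ∈ insert x (Set.range u)} :=
    fun n => ⟨y n, hy n, by rw [hgy n]; exact Or.inr ⟨n, rfl⟩⟩
  obtain ⟨g₀, -, hg₀⟩ : ∃ g₀ ∈ {g : G | ∃ z ∈ K, g • z ∈ insert x (Set.range u)},
      ∃ᶠ n in atTop, g n = g₀ := by
    by_contra hno
    push Not at hno
    have := (eventually_all_finite hfin2).2 hno
    obtain ⟨n, hn⟩ := this.exists
    exact hn _ (hmem n) rfl
  have hx : x ∈ (fun y => g₀ • y) '' K :=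
    (hc g₀).isClosed.mem_of_frequently_of_tendsto
      (hg₀.mono fun n hn => ⟨y n, hy n, by simp [← hn, hgy n]⟩) hu
  obtain ⟨n, hn⟩ := hg₀.exists
  exact hun n (Set.mem_biUnion (x := g₀) hx ⟨y n, hy n, by simp [← hn, hgy n]⟩)

/-- Compactness of `K` gives a uniform radius for balls centred in `K`; the action carries it
everywhere. -/
theorem exists_isCompact_closedBall (hG : IsGeometricAction G X) :
    ∃ ε > 0, ∀ x : X, IsCompact (Metric.closedBall x ε) := by
  have := hG.isIsometricSMul
  obtain ⟨K, hK, hcov⟩ := hG.cocompact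
  have : WeaklyLocallyCompactSpace X :=
    ⟨fun x => (hG.exists_isCompact_mem_nhds x).imp fun _ h => h.symm⟩
  obtain ⟨L, hL, hKL⟩ := exists_compact_superset hK
  obtain ⟨ε, hε, hsub⟩ := hK.exists_cthickening_subset_open isOpen_interior hKL
  refine ⟨ε, hε, fun x => ?_⟩
  obtain ⟨g, y, hy, rfl⟩ := hcov x
  rw [← Metric.smul_closedBall]
  refine IsCompact.smul g (hL.of_isClosed_subset Metric.isClosed_closedBall ?_)
  exact ((Metric.closedBall_subset_cthickening hy ε).trans hsub).trans interior_subset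

/-- A space with a geometric action is proper. -/
theorem properSpace (hG : IsGeometricAction G X) (hX : IsGeodesicSpace X) : ProperSpace X := by
  obtain ⟨ε, hε, hc⟩ := hG.exists_isCompact_closedBall
  -- A geodesic to a point of the larger ball passes within `ε / 4` of it inside the smaller ball,
  -- so the compact `ε`-balls about a finite `ε / 4`-net of the latter cover the former.
  have step : ∀ (x : X) (r : ℝ), IsCompact (Metric.closedBall x r) →
      IsCompact (Metric.closedBall x (r + ε / 4)) := by
    intro x r hr
    rcases lt_or_ge r 0 with h0 | h0
    · refine (hc x).of_isClosed_subset Metric.isClosed_closedBall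
        (Metric.closedBall_subset_closedBall (by linarith))
    obtain ⟨t, -, ht, hcov⟩ := hr.finite_cover_balls (e := ε / 4) (by linarith)
    refine (ht.isCompact_biUnion fun y _ => hc y).of_isClosed_subset Metric.isClosed_closedBall ?_
    intro z hz
    rw [Metric.mem_closedBall, dist_comm] at hz
    obtain ⟨γ, hγ⟩ := hX x z
    obtain ⟨w, hw, hwz⟩ : ∃ w ∈ Metric.closedBall x r, dist z w ≤ ε / 4 := by
      rcases le_total (dist x z) r with h | h
      · exact ⟨z, by rwa [Metric.mem_closedBall, dist_comm], by rw [dist_self]; positivity⟩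
      · refine ⟨γ r, ?_, ?_⟩
        · rw [Metric.mem_closedBall, dist_comm, hγ.dist_source ⟨h0, h⟩]
        · rw [dist_comm, hγ.dist_target ⟨h0, h⟩]; linarith
    obtain ⟨y, hy, hwy⟩ := Set.mem_iUnion₂.1 (hcov hw)
    refine Set.mem_biUnion hy ?_
    have h1 := dist_triangle z w y
    rw [Metric.mem_ball] at hwy
    rw [Metric.mem_closedBall]
    linarith
  refine ⟨fun x r => ?_⟩
  have h : ∀ n : ℕ, IsCompact (Metric.closedBall x (n * (ε / 4))) := by
    intro n
    induction n with
    | zero => simp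
    | succ n ih =>
      have := step x _ ih
      convert this using 2
      push_cast; ring
  obtain ⟨n, hn⟩ := exists_nat_ge (r / (ε / 4))
  refine (h n).of_isClosed_subset Metric.isClosed_closedBall
    (Metric.closedBall_subset_closedBall ?_)
  rwa [div_le_iff₀ (by positivity)] at hn

/-- Limits of pointed maps: after recentring, a sequence of maps into a proper cocompact space
converges along an ultrafilter. -/
theorem exists_limit_map [ProperSpace X] (hG : IsGeometricAction G X) {S : Type*}
    (f : ℕ → S → X) (s₀ : S) (C : S → ℝ) (hC : ∀ s, ∀ᶠ n in atTop, dist (f n s) (f n s₀) ≤ C s) :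
    ∃ φ : S → X, ∀ s t, Tendsto (fun n => dist (f n s) (f n t)) (hyperfilter ℕ : Filter ℕ)
      (𝓝 (dist (φ s) (φ t))) := by
  have := hG.isIsometricSMul
  obtain ⟨K, hK, hcov⟩ := hG.cocompact
  choose g y hy hgy using fun n => hcov (f n s₀)
  -- An ultrafilter makes the images of all `s` converge at once, even for uncountable `S`.
  have hlim : ∀ s, ∃ x, Tendsto (fun n => (g n)⁻¹ • f n s) (hyperfilter ℕ : Filter ℕ) (𝓝 x) := by
    intro s
    have hev : ∀ᶠ n in (hyperfilter ℕ : Filter ℕ),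
        (g n)⁻¹ • f n s ∈ Metric.cthickening (C s) K := by
      refine ((hC s).filter_mono Nat.hyperfilter_le_atTop).mono fun n hn => ?_
      refine Metric.mem_cthickening_of_dist_le _ (y n) _ _ (hy n) ?_
      rw [← dist_smul (g n), smul_inv_smul, hgy n]
      exact hn
    obtain ⟨x, -, hx⟩ := (hK.cthickening (r := C s)).ultrafilter_le_nhds
      ((hyperfilter ℕ).map fun n => (g n)⁻¹ • f n s) (by
        rw [le_principal_iff]; exact hev)
    exact ⟨x, hx⟩
  choose φ hφ using hlim
  refine ⟨φ, fun s t => ?_⟩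
  have := (hφ s).dist (hφ t)
  simpa only [dist_smul] using this

end IsGeometricAction

end Proper

/-! ### Bieberbach's argument: translations in crystallographic groups -/

/-- The group `Γ` acts on `E` by the isometries `x ↦ A g x + a g`, properly and coboundedly. -/
structure IsCrystallographic {Γ E : Type*} [Group Γ] [NormedAddCommGroup E]
    [InnerProductSpace ℝ E] (A : Γ → E →L[ℝ] E) (a : Γ → E) : Prop where
  linear_mul : ∀ g h, A (g * h) = A g * A h
  linear_one : A 1 = 1
  norm_linear : ∀ g x, ‖A g x‖ = ‖x‖
  trans_mul : ∀ g h, a (g * h) = A g (a h) + a g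
  finite : ∀ R : ℝ, {g | ‖a g‖ ≤ R}.Finite
  cobounded : ∃ R : ℝ, ∀ x, ∃ g, ‖a g - x‖ ≤ R

namespace IsCrystallographic

variable {Γ E : Type*} [Group Γ] [NormedAddCommGroup E] [InnerProductSpace ℝ E]
  {A : Γ → E →L[ℝ] E} {a : Γ → E}

theorem norm_le_one (h : IsCrystallographic A a) (g : Γ) : ‖A g‖ ≤ 1 :=
  (A g).opNorm_le_bound zero_le_one fun x => by rw [h.norm_linear, one_mul]

theorem norm_mul_le (h : IsCrystallographic A a) (T : E →L[ℝ] E) (g : Γ) : ‖T * A g‖ ≤ ‖T‖ :=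
  (norm_mul_le_of_le le_rfl (h.norm_le_one g)).trans (by rw [mul_one])

theorem norm_mul_le' (h : IsCrystallographic A a) (T : E →L[ℝ] E) (g : Γ) : ‖A g * T‖ ≤ ‖T‖ :=
  (norm_mul_le_of_le (h.norm_le_one g) le_rfl).trans (by rw [one_mul])

theorem exists_min (h : IsCrystallographic A a) {S : Set Γ} (hS : S.Nonempty) :
    ∃ g ∈ S, ∀ g' ∈ S, ‖a g‖ ≤ ‖a g'‖ := by
  obtain ⟨g₀, hg₀⟩ := hS
  obtain ⟨g, hg, hmin⟩ := Set.exists_min_image (S ∩ {g | ‖a g‖ ≤ ‖a g₀‖}) (fun g => ‖a g‖)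
    ((h.finite _).inter_of_right _) ⟨g₀, hg₀, le_refl ‖a g₀‖⟩
  refine ⟨g, hg.1, fun g' hg' => ?_⟩
  rcases le_total ‖a g'‖ ‖a g₀‖ with h1 | h1
  · exact hmin g' ⟨hg', h1⟩
  · exact le_trans hg.2 h1

/-- Every direction is approximated by the translation parts of elements with small rotation
part. -/
theorem exists_approx [FiniteDimensional ℝ E] (h : IsCrystallographic A a) (u : E) {ε : ℝ}
    (hε : 0 < ε) : ∃ g, ∃ t : ℝ, 0 < t ∧ ‖a g - t • u‖ ≤ ε * t ∧ ‖A g - 1‖ ≤ ε := by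
  obtain ⟨R, hR⟩ := h.cobounded
  choose k hk using fun n : ℕ => hR ((n : ℝ) • u)
  have : ProperSpace (E →L[ℝ] E) := FiniteDimensional.proper ℝ _
  obtain ⟨B, -, φ, hφ, hB⟩ := (isCompact_closedBall (0 : E →L[ℝ] E) 1).tendsto_subseq
    (x := fun n => A (k n)) (fun n => by simpa using h.norm_le_one (k n))
  obtain ⟨N, hN⟩ := Metric.cauchySeq_iff'.1 hB.cauchySeq ε hε
  set i := φ N
  obtain ⟨n, hn⟩ := exists_nat_gt (max ((R + ‖a (k i)‖) / ε) N)
  have hn1 := (le_max_left _ _).trans_lt hn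
  have hn2 : N < n := by exact_mod_cast (le_max_right _ _).trans_lt hn
  have hnφ : (n : ℝ) ≤ φ n := by exact_mod_cast hφ.id_le n
  have hR0 : 0 ≤ R := (norm_nonneg _).trans (hk 0)
  have hlin : A (k (φ n) * (k i)⁻¹) * A (k i) = A (k (φ n)) := by
    rw [← h.linear_mul, inv_mul_cancel_right]
  have htr : A (k (φ n) * (k i)⁻¹) (a (k i)) + a (k (φ n) * (k i)⁻¹) = a (k (φ n)) := by
    rw [← h.trans_mul, inv_mul_cancel_right]
  -- In the quotient the two nearby rotation parts almost cancel, while the translation part changes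
  -- by at most the fixed amount `‖a (k i)‖`, negligible against `φ n`.
  refine ⟨k (φ n) * (k i)⁻¹, φ n, ?_, ?_, ?_⟩
  · have : (0 : ℝ) < n := by exact_mod_cast (Nat.zero_le N).trans_lt hn2
    linarith
  · have e : a (k (φ n) * (k i)⁻¹) - (φ n : ℝ) • u =
        (a (k (φ n)) - (φ n : ℝ) • u) - A (k (φ n) * (k i)⁻¹) (a (k i)) := by
      rw [← htr]; abel
    rw [e]
    refine (norm_sub_le _ _).trans ?_
    rw [h.norm_linear]
    rw [div_lt_iff₀ hε] at hn1
    nlinarith [hk (φ n)]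
  · have e : A (k (φ n) * (k i)⁻¹) - 1 = (A (k (φ n)) - A (k i)) * A (k i)⁻¹ := by
      rw [sub_mul, ← h.linear_mul, ← h.linear_mul, mul_inv_cancel, h.linear_one]
    rw [e]
    refine (h.norm_mul_le _ _).trans ?_
    have := hN n hn2.le
    rw [dist_eq_norm] at this
    exact this.le

/-- The additive commutator of `A g` and `A k` equals that of `A g - 1` and `A k - 1`, so the
rotation part of a group commutator is quadratically small. -/
theorem norm_commutator_sub_one_le (h : IsCrystallographic A a) (g k : Γ) :
    ‖A (g * k * g⁻¹ * k⁻¹) - 1‖ ≤ 2 * ‖A g - 1‖ * ‖A k - 1‖ := by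
  have e : A (g * k * g⁻¹ * k⁻¹) - 1 =
      ((A g - 1) * (A k - 1) - (A k - 1) * (A g - 1)) * A (k * g)⁻¹ := by
    have e1 : (A g - 1) * (A k - 1) - (A k - 1) * (A g - 1) = A (g * k) - A (k * g) := by
      rw [h.linear_mul, h.linear_mul]; noncomm_ring
    rw [e1, sub_mul, ← h.linear_mul, ← h.linear_mul, mul_inv_cancel, h.linear_one]
    simp [mul_assoc]
  rw [e]
  refine (h.norm_mul_le _ _).trans ((norm_sub_le _ _).trans ?_)
  have h1 := _root_.norm_mul_le (A g - 1) (A k - 1)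
  have h2 := _root_.norm_mul_le (A k - 1) (A g - 1)
  linarith

/-- To leading order, commutation with `g` applies `A g - 1` to translation parts; this is what
shortens elements. -/
theorem norm_trans_commutator_le (h : IsCrystallographic A a) (g k : Γ) :
    ‖a (g * k * g⁻¹ * k⁻¹) - (A g - 1) (a k)‖ ≤
      ‖A (g * k * g⁻¹ * k⁻¹) - 1‖ * ‖a k‖ + ‖A k - 1‖ * ‖a g‖ := by
  set c := g * k * g⁻¹ * k⁻¹ with hc
  have e1 : A c (a (k * g)) + a c = a (g * k) := by
    rw [← h.trans_mul, hc]; congr 1; group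
  rw [h.trans_mul k g, h.trans_mul g k, map_add] at e1
  have e2 : A c (A k (a g)) = A (g * k * g⁻¹) (a g) := by
    have : g * k * g⁻¹ = c * k := by rw [hc]; group
    rw [this, h.linear_mul c k]; rfl
  rw [e2] at e1
  have e3 : a c - (A g - 1) (a k) = -((A c - 1) (a k)) - (A (g * k * g⁻¹) - 1) (a g) := by
    have : a c = A g (a k) + a g - (A (g * k * g⁻¹) (a g) + A c (a k)) := by rw [← e1]; abel
    rw [this]
    simp only [sub_apply, one_apply_eq_self]
    abel
  have e4 : A (g * k * g⁻¹) - 1 = A g * (A k - 1) * A g⁻¹ := by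
    rw [mul_sub, sub_mul, mul_one, ← h.linear_mul, ← h.linear_mul, ← h.linear_mul, mul_inv_cancel,
      h.linear_one]
  have e5 : ‖A (g * k * g⁻¹) - 1‖ ≤ ‖A k - 1‖ := by
    rw [e4]; exact (h.norm_mul_le _ _).trans (h.norm_mul_le' _ _)
  rw [e3]
  refine (norm_sub_le _ _).trans ?_
  rw [norm_neg]
  exact add_le_add ((A c - 1).le_opNorm _)
    (((A (g * k * g⁻¹) - 1).le_opNorm _).trans (mul_le_mul_of_nonneg_right e5 (norm_nonneg _)))

/-- `A g - 1` is normal. -/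
theorem norm_sub_sq_le (h : IsCrystallographic A a) (g : Γ) (x : E) :
    ‖(A g - 1) x‖ ^ 2 ≤ ‖(A g - 1) ((A g - 1) x)‖ * ‖x‖ := by
  -- For orthogonal `A g`, the adjoint of `A g - 1` is `-(A g)⁻¹ (A g - 1)`.
  have key : ‖(A g - 1) x‖ ^ 2 = -inner ℝ ((A g - 1) ((A g - 1) x)) (A g x) := by
    have h1 : inner ℝ (A g (A g x)) (A g x) = inner ℝ (A g x) x := by
      rw [real_inner_eq_norm_add_mul_self_sub_norm_mul_self_sub_norm_mul_self_div_two,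
        real_inner_eq_norm_add_mul_self_sub_norm_mul_self_sub_norm_mul_self_div_two, ← map_add,
        h.norm_linear, h.norm_linear]
      simp [h.norm_linear]
    simp only [sub_apply, one_apply_eq_self, map_sub,
      inner_sub_left, h1, norm_sub_sq_real, h.norm_linear, real_inner_self_eq_norm_sq]
    rw [real_inner_comm x]
    ring
  rw [key, ← inner_neg_left]
  refine (real_inner_le_norm _ _).trans ?_
  rw [norm_neg, h.norm_linear]

/-- Elements with small rotation part are translations. -/
theorem linear_eq_one [FiniteDimensional ℝ E] (h : IsCrystallographic A a) {g : Γ}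
    (hg : ‖A g - 1‖ ≤ 1 / 4) : A g = 1 := by
  by_contra hne
  obtain ⟨α, ⟨hα, hα1⟩, hmin⟩ := h.exists_min (S := {g | ‖A g - 1‖ ≤ 1 / 4 ∧ A g ≠ 1}) ⟨g, hg, hne⟩
  set m := ‖A α - 1‖ with hm
  have hm0 : 0 < m := norm_pos_iff.2 (sub_ne_zero.2 hα1)
  have hN : ∀ x, ‖(A α - 1) x‖ ≤ m * ‖x‖ := fun x => (A α - 1).le_opNorm x
  -- The class of `β` is designed to be stable under commutation with `α`: small rotation, and
  -- translation in a direction that `A α - 1` shrinks by no less than about half its norm. The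
  -- slack `32 * ‖A β - 1‖` pays for the errors in the commutator.
  have hex : ∃ β, a β ≠ 0 ∧ ‖A β - 1‖ ≤ m / 8 ∧
      (m / 2 + 32 * ‖A β - 1‖) * ‖a β‖ ≤ ‖(A α - 1) (a β)‖ := by
    obtain ⟨x, hx⟩ : ∃ x, 9 / 10 * m * ‖x‖ < ‖(A α - 1) x‖ := by
      by_contra! hc
      have := (A α - 1).opNorm_le_bound (by positivity) hc
      rw [← hm] at this
      linarith
    have hx0 : 0 < ‖x‖ := by
      rcases (norm_nonneg x).eq_or_lt with h0 | h0
      · rw [norm_eq_zero.1 h0.symm] at hx; simp at hx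
      · exact h0
    set u := ‖x‖⁻¹ • x with hu
    have hu1 : ‖u‖ = 1 := by rw [hu, norm_smul, norm_inv, norm_norm, inv_mul_cancel₀ hx0.ne']
    have hux : 9 / 10 * m ≤ ‖(A α - 1) u‖ := by
      rw [hu, map_smul, norm_smul, norm_inv, norm_norm, inv_mul_eq_div, le_div_iff₀ hx0]
      exact hx.le
    obtain ⟨β, t, ht, h1, h2⟩ := h.exists_approx u (ε := m / 1000) (by positivity)
    have ht1 : ‖t • u‖ = t := by rw [norm_smul, hu1, mul_one, Real.norm_of_nonneg ht.le]
    have hb1 : ‖a β‖ ≤ t + m / 1000 * t := by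
      have := norm_add_le (t • u) (a β - t • u)
      rw [add_sub_cancel] at this
      linarith
    have hb2 : t - m / 1000 * t ≤ ‖a β‖ := by
      have := norm_sub_norm_le (t • u) (t • u - a β)
      rw [sub_sub_cancel, norm_sub_rev] at this
      linarith
    have hb3 : 9 / 10 * m * t - m * (m / 1000 * t) ≤ ‖(A α - 1) (a β)‖ := by
      have e : (A α - 1) (a β) = t • (A α - 1) u + (A α - 1) (a β - t • u) := by
        rw [map_sub, map_smul _ t u, add_sub_cancel]
      have e1 := norm_sub_le ((A α - 1) (a β)) ((A α - 1) (a β - t • u))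
      have e2 : (A α - 1) (a β) - (A α - 1) (a β - t • u) = t • (A α - 1) u := by
        rw [e]; abel
      rw [e2, norm_smul, Real.norm_of_nonneg ht.le] at e1
      have e3 := (hN (a β - t • u)).trans (mul_le_mul_of_nonneg_left h1 hm0.le)
      nlinarith
    refine ⟨β, ?_, by linarith, ?_⟩
    · rw [← norm_pos_iff]; nlinarith
    · have : (m / 2 + 32 * ‖A β - 1‖) * ‖a β‖ ≤ (m / 2 + 32 * (m / 1000)) * (t + m / 1000 * t) := by
        gcongr
      refine this.trans (le_trans ?_ hb3)
      have : 0 < m * t := by positivity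
      nlinarith
  obtain ⟨β, ⟨hβ0, hβ1, hβ2⟩, hβmin⟩ := h.exists_min hex
  set μ := ‖A β - 1‖ with hμ
  have hμ0 : 0 ≤ μ := norm_nonneg _
  set b := ‖a β‖ with hb
  have hb0 : 0 < b := norm_pos_iff.2 hβ0
  set c := α * β * α⁻¹ * β⁻¹ with hc
  set μ' := ‖A c - 1‖ with hμ'
  have hμμ : μ' ≤ 2 * m * μ := h.norm_commutator_sub_one_le α β
  have hr : ‖a c - (A α - 1) (a β)‖ ≤ 2 * μ * b := by
    have h1 := h.norm_trans_commutator_le α β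
    have h2 : μ * ‖a α‖ ≤ μ * b := by
      -- Either `β` is a translation and the term vanishes, or `β` competes with `α`, whose
      -- translation part is minimal.
      rcases hμ0.eq_or_lt with h0 | h0
      · rw [← h0]; simp
      · refine mul_le_mul_of_nonneg_left (hmin β ⟨by linarith, fun hB => ?_⟩) hμ0
        rw [hμ, hB, sub_self, norm_zero] at h0
        exact lt_irrefl _ h0
    have h3 : μ' * b ≤ 2 * m * μ * b := mul_le_mul_of_nonneg_right hμμ hb0.le
    have h4 : 0 ≤ μ * b := by positivity
    have h5 : 2 * m * μ * b ≤ μ * b := by nlinarith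
    linarith
  set q := ‖(A α - 1) (a β)‖ with hq
  have hc1 : ‖a c‖ ≤ q + 2 * μ * b := by
    have := norm_add_le ((A α - 1) (a β)) (a c - (A α - 1) (a β))
    rw [add_sub_cancel] at this
    linarith
  have hc2 : q - 2 * μ * b ≤ ‖a c‖ := by
    have := norm_sub_le (a c) (a c - (A α - 1) (a β))
    rw [sub_sub_cancel] at this
    linarith
  have hqm : q ≤ m * b := hN _
  have hcpos : 0 < ‖a c‖ := by
    have : 0 < m * b := by positivity
    nlinarith [mul_nonneg hμ0 hb0.le]
  have hclt : ‖a c‖ < b := by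
    have : μ * b ≤ 1 / 32 * b := mul_le_mul_of_nonneg_right (by linarith) hb0.le
    have : m * b ≤ 1 / 4 * b := mul_le_mul_of_nonneg_right hα hb0.le
    linarith
  -- The commutator is shorter than `β`. It remains in the class because normality of `A α - 1`
  -- keeps its stretching ratio from dropping on iteration.
  refine absurd (hβmin c ⟨norm_pos_iff.1 hcpos, ?_, ?_⟩) (not_le.2 hclt)
  · have : m * μ ≤ 1 / 4 * μ := mul_le_mul_of_nonneg_right hα hμ0
    change μ' ≤ _
    linarith
  · change (m / 2 + 32 * μ') * ‖a c‖ ≤ _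
    set w := ‖(A α - 1) ((A α - 1) (a β))‖ with hw
    have hw1 : q ^ 2 ≤ w * b := h.norm_sub_sq_le α (a β)
    have hw2 : w - m * (2 * μ * b) ≤ ‖(A α - 1) (a c)‖ := by
      have e1 := norm_sub_le ((A α - 1) (a c)) ((A α - 1) (a c - (A α - 1) (a β)))
      rw [← map_sub, sub_sub_cancel] at e1
      have e3 := (hN (a c - (A α - 1) (a β))).trans (mul_le_mul_of_nonneg_left hr hm0.le)
      linarith
    refine le_trans ?_ hw2
    have h1 : (m / 2 + 32 * μ') * ‖a c‖ ≤ (m / 2 + 32 * (2 * m * μ)) * (q + 2 * μ * b) := by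
      gcongr
    refine h1.trans (le_of_mul_le_mul_right ?_ hb0)
    have h2 : (w - m * (2 * μ * b)) * b ≥ q ^ 2 - m * (2 * μ * b) * b := by
      rw [sub_mul]; linarith
    refine le_trans ?_ h2
    -- with `q = ρ * b` this is an inequality between `ρ`, `m` and `μ`
    obtain ⟨ρ, hρ⟩ : ∃ ρ, q = ρ * b := ⟨q / b, by field_simp⟩
    rw [hρ] at hβ2 hqm ⊢
    have hρ1 : m / 2 + 32 * μ ≤ ρ := le_of_mul_le_mul_right hβ2 hb0
    have hρ2 : ρ ≤ m := le_of_mul_le_mul_right hqm hb0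
    have main : (m / 2 + 32 * (2 * m * μ)) * (ρ + 2 * μ) ≤ ρ ^ 2 - 2 * m * μ := by
      have a1 : 0 ≤ (ρ - m / 2 - 32 * μ) * ρ := mul_nonneg (by linarith) (by linarith)
      have a2 : 0 ≤ μ * (m * (1 / 4 - m)) := by
        have : 0 ≤ 1 / 4 - m := by linarith
        positivity
      have a3 : 0 ≤ m * μ * (m / 8 - μ) := by
        have : 0 ≤ m / 8 - μ := by linarith
        positivity
      have a4 : 0 ≤ μ * (1 / 4 - m) * ρ := by
        have : 0 ≤ 1 / 4 - m := by linarith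
        have : 0 ≤ ρ := by linarith
        positivity
      have a5 : 0 ≤ μ * (ρ - m / 2) := mul_nonneg hμ0 (by linarith)
      nlinarith
    have := mul_le_mul_of_nonneg_right main (sq_nonneg b)
    linarith

/-- There are two translations in independent directions in dimension at least two. -/
theorem exists_translations [FiniteDimensional ℝ E] (h : IsCrystallographic A a)
    (hE : 2 ≤ Module.finrank ℝ E) : ∃ g k, A g = 1 ∧ A k = 1 ∧
      ∀ x y : ℝ, x • a g + y • a k = 0 → x = 0 ∧ y = 0 := by
  have b := stdOrthonormalBasis ℝ E
  set u := b ⟨0, by omega⟩ with hu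
  set v := b ⟨1, by omega⟩ with hv
  have huv : inner ℝ u v = 0 := b.orthonormal.2 (by simp)
  have hu1 : ‖u‖ = 1 := b.orthonormal.1 _
  have hv1 : ‖v‖ = 1 := b.orthonormal.1 _
  obtain ⟨g, t, ht, h1, h2⟩ := h.exists_approx u (ε := 1 / 4) (by norm_num)
  obtain ⟨k, s, hs, h3, h4⟩ := h.exists_approx v (ε := 1 / 4) (by norm_num)
  refine ⟨g, k, h.linear_eq_one h2, h.linear_eq_one h4, fun x y hxy => ?_⟩
  have e1 : (x * t) • u + (y * s) • v = -(x • (a g - t • u) + y • (a k - s • v)) := by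
    have : x • (a g - t • u) + y • (a k - s • v) =
      (x • a g + y • a k) - ((x * t) • u + (y * s) • v) := by module
    rw [this, hxy, zero_sub, neg_neg]
  have e2 : ‖(x * t) • u + (y * s) • v‖ ^ 2 = (x * t) ^ 2 + (y * s) ^ 2 := by
    rw [norm_add_sq_real, real_inner_smul_left, real_inner_smul_right, huv, norm_smul, norm_smul,
      hu1, hv1]
    simp [mul_pow]
  have e3 : ‖(x * t) • u + (y * s) • v‖ ≤ 1 / 4 * (|x * t| + |y * s|) := by
    rw [e1, norm_neg]
    refine (norm_add_le _ _).trans ?_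
    rw [norm_smul, norm_smul, abs_mul, abs_mul, abs_of_pos ht, abs_of_pos hs, Real.norm_eq_abs,
      Real.norm_eq_abs]
    nlinarith [mul_le_mul_of_nonneg_left h1 (abs_nonneg x),
      mul_le_mul_of_nonneg_left h3 (abs_nonneg y)]
  have e4 := pow_le_pow_left₀ (norm_nonneg _) e3 2
  rw [e2, ← sq_abs (x * t), ← sq_abs (y * s)] at e4
  have e5 : |x * t| ^ 2 + |y * s| ^ 2 ≤ 0 := by
    nlinarith [sq_nonneg (|x * t| - |y * s|)]
  have e6 : |x * t| = 0 := by nlinarith [sq_nonneg (|x * t|), sq_nonneg (|y * s|)]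
  have e7 : |y * s| = 0 := by nlinarith [sq_nonneg (|x * t|), sq_nonneg (|y * s|)]
  rw [abs_eq_zero, mul_eq_zero] at e6 e7
  exact ⟨e6.resolve_right ht.ne', e7.resolve_right hs.ne'⟩

end IsCrystallographic

/-! ### The flat plane theorem -/

/-- A convex sequence that neither falls nor rises too steeply has almost equal consecutive
slopes somewhere. -/
theorem exists_slopes_close {N : ℕ} (hN : 1 ≤ N) {g : ℕ → ℝ} (h1 : g 0 - 7 / 8 * N ≤ g 1)
    (hup : ∀ i ≤ 6 * N + 2, g i ≤ g 0 + 1 / 2)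
    (hconv : ∀ i, i + 2 ≤ 6 * N + 2 → 2 * g (i + 1) ≤ g i + g (i + 2)) :
    ∃ i, i + 2 ≤ 6 * N + 2 ∧ (g (i + 2) - g (i + 1)) - (g (i + 1) - g i) ≤ 1 ∧
      g (i + 2) - g (i + 1) ≤ N / 2 ∧ -7 / 8 * N ≤ g (i + 2) - g (i + 1) := by
  have hN' : (1 : ℝ) ≤ N := by exact_mod_cast hN
  have hmono : ∀ j, j + 1 ≤ 6 * N + 2 → -7 / 8 * (N : ℝ) ≤ g (j + 1) - g j := by
    intro j
    induction j with
    | zero => intro _; rw [zero_add]; linarith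
    | succ j ih => intro hj; have := ih (by omega); have := hconv j hj; linarith
  by_contra! hc
  -- If the claim fails, the slope rises by more than `1` per step until it exceeds `N / 2`. Then `2
  -- * N` steps lose at most `2 * N ^ 2`, and the other `4 * N + 2` gain at least `2 * N ^ 2 + N`,
  -- contradicting the upper bound.
  have hlow : ∀ i, i + 1 ≤ 6 * N + 2 → min (-N + i : ℝ) (N / 2) ≤ g (i + 1) - g i := by
    intro i
    induction i with
    | zero =>
      intro _
      refine (min_le_left _ _).trans ?_
      rw [zero_add, Nat.cast_zero]
      linarith
    | succ i ih =>
      intro hi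
      rcases le_or_gt ((g (i + 2) - g (i + 1)) - (g (i + 1) - g i)) 1 with h | h
      · rcases le_or_gt (g (i + 2) - g (i + 1)) (N / 2 : ℝ) with h' | h'
        · exact absurd (hmono (i + 1) hi) (not_le.2 (hc i hi h h'))
        · exact (min_le_right _ _).trans h'.le
      · rcases min_le_iff.1 (ih (by omega)) with h' | h'
        · refine (min_le_left _ _).trans ?_
          rw [Nat.cast_succ]; linarith
        · exact (min_le_right _ _).trans (by linarith)
  have hfirst : ∀ i, i ≤ 2 * N → g 0 - i * N ≤ g i := by
    intro i
    induction i with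
    | zero => intro _; simp
    | succ i ih =>
      intro hi
      have h1 := ih (by omega)
      have h3 := hmono i (by omega)
      rw [Nat.cast_succ]
      linarith
  have hsecond : ∀ j, j ≤ 4 * N + 2 → g 0 - 2 * N * N + j * (N / 2) ≤ g (2 * N + j) := by
    intro j
    induction j with
    | zero =>
      intro _
      have := hfirst (2 * N) le_rfl
      rw [Nat.cast_mul, Nat.cast_two] at this
      rw [Nat.cast_zero, add_zero]
      linarith
    | succ j ih =>
      intro hj
      have h1 := ih (by omega)
      have h2 := hlow (2 * N + j) (by omega)
      rw [min_eq_right (by push_cast; linarith [(Nat.cast_nonneg j : (0 : ℝ) ≤ j)])] at h2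
      rw [← add_assoc, Nat.cast_succ]
      linarith
  have h2 := hsecond (4 * N + 2) le_rfl
  have h3 := hup (2 * N + (4 * N + 2)) (by omega)
  push_cast at h2
  nlinarith

namespace IsCAT0

variable {X : Type*} [MetricSpace X]

/-- If the side opposite to `x` in a triangle is far from `x` but the sides issuing from `x`
diverge, then this also happens in a triangle whose comparison angle at `x` is not obtuse. -/
theorem exists_nonobtuse (hX : IsCAT0 X) {x y z : X} {α ρ η : ℝ → X} {n : ℝ} (hn : 1 ≤ n)
    (hα : IsGeodesicSegment α x y) (hρ : IsGeodesicSegment ρ x z) (hη : IsGeodesicSegment η y z)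
    (hfar : ∀ t ∈ Set.Icc 0 (dist y z), n < dist x (η t)) (hdiv : 1 ≤ dist (α 1) (ρ 1)) :
    ∃ (u v : X) (α' ρ' : ℝ → X), IsGeodesicSegment α' x u ∧ IsGeodesicSegment ρ' x v ∧
      n ≤ dist x u ∧ n ≤ dist x v ∧ 1 / 2 ≤ dist (α' 1) (ρ' 1) ∧
      dist u v ^ 2 ≤ dist x u ^ 2 + dist x v ^ 2 := by
  set l := dist y z with hl
  have hl0 : 0 ≤ l := dist_nonneg
  choose ω hω using fun t => hX.geodesic x (η t)
  have hy : n < dist x y := by have := hfar 0 ⟨le_rfl, hl0⟩; rwa [hη.source] at this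
  have hz : n < dist x z := by have := hfar l ⟨hl0, le_rfl⟩; rwa [hη.target] at this
  have hcont : ContinuousOn (fun t => dist (α 1) (ω t 1)) (Set.Icc 0 l) := by
    refine (continuous_const.dist continuous_id).comp_continuousOn (LipschitzOnWith.continuousOn (K := 1)
      (LipschitzOnWith.of_dist_le_mul fun s hs t ht => ?_))
    have := hX.dist_unit_le (hω s) (hω t) (hn.trans (hfar s hs).le) (hn.trans (hfar t ht).le)
    rw [hη.isometric s hs t ht] at this
    simpa [Real.dist_eq] using this
  have h0 : dist (α 1) (ω 0 1) ≤ 1 / 2 := by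
    have := hX.dist_unit_le hα (hω 0) (by linarith) (hn.trans (hfar 0 ⟨le_rfl, hl0⟩).le)
    rw [hη.source, dist_self] at this
    linarith
  have h1 : 1 / 2 ≤ dist (α 1) (ω l 1) := by
    have := hX.dist_unit_le (hω l) hρ (hn.trans (hfar l ⟨hl0, le_rfl⟩).le) (by linarith)
    rw [hη.target, dist_self] at this
    have := dist_triangle (α 1) (ω l 1) (ρ 1)
    linarith
  -- The triangle is cut from `x` into two that both still diverge by `1 / 2`. If both comparison
  -- angles at `x` were obtuse, the Bruhat-Tits inequality at `η t` would fail.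
  obtain ⟨t, ht, hmid⟩ := intermediate_value_Icc hl0 hcont ⟨h0, h1⟩
  have hmid : dist (α 1) (ω t 1) = 1 / 2 := hmid
  have hw := hfar t ht
  rcases le_or_gt (dist y (η t) ^ 2) (dist x y ^ 2 + dist x (η t) ^ 2) with h | h
  · exact ⟨y, η t, α, ω t, hα, hω t, hy.le, hw.le, hmid.ge, h⟩
  · refine ⟨η t, z, ω t, ρ, hω t, hρ, hw.le, hz.le, ?_, ?_⟩
    · have := dist_triangle (α 1) (ω t 1) (ρ 1)
      linarith
    · have key := hX.dist_sq_le_path (c := η) ht.1 ht.2 hη.isometric x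
      rw [hη.source, hη.target] at key
      rw [hη.dist_source ht] at h
      rw [hη.dist_target ht]
      by_contra! h'
      have hw0 : 0 < dist x (η t) ^ 2 := by
        have : 0 < dist x (η t) := by linarith
        positivity
      have hlt : 0 < l := by
        rcases hl0.eq_or_lt with e | e
        · exfalso
          have : t = 0 := by linarith [ht.1, ht.2]
          rw [this] at h
          nlinarith [sq_nonneg (dist x y), sq_nonneg (dist x (η 0))]
        · exact e
      change (l - 0) * _ ≤ _ at key
      have h2 := mul_le_mul_of_nonneg_left h.le (sub_nonneg.2 ht.2)
      have h3 := mul_le_mul_of_nonneg_left h'.le ht.1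
      change (dist y z - t) * _ ≤ _ at h2
      rw [← hl] at h2 h3
      have h4 := mul_pos hlt hw0
      nlinarith

/-- In a space that is not hyperbolic there are arbitrarily large triangles which are not obtuse at
a vertex `x` but whose sides at `x` diverge near `x`. -/
theorem exists_fat (hX : IsCAT0 X) (hh : ¬ IsHyperbolicSpace X) {n : ℝ} (hn : 1 ≤ n) :
    ∃ (x u v : X) (α ρ : ℝ → X), IsGeodesicSegment α x u ∧ IsGeodesicSegment ρ x v ∧
      n ≤ dist x u ∧ n ≤ dist x v ∧ 1 / 2 ≤ dist (α 1) (ρ 1) ∧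
      dist u v ^ 2 ≤ dist x u ^ 2 + dist x v ^ 2 := by
  have : ¬ ∃ δ : ℝ, ∀ (p q r : X) (α β γ : ℝ → X),
      IsGeodesicSegment α p q → IsGeodesicSegment β q r → IsGeodesicSegment γ r p →
      ∀ x ∈ α '' Set.Icc 0 (dist p q),
        ∃ y ∈ β '' Set.Icc 0 (dist q r) ∪ γ '' Set.Icc 0 (dist r p), dist x y ≤ δ :=
    fun h => hh ⟨hX.geodesic, h⟩
  push Not at this
  obtain ⟨p, q, r, α, β, γ, hα, hβ, hγ, _, ⟨t, ht, rfl⟩, hfar⟩ := this n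
  have hp : n < dist p (α t) := by
    rw [dist_comm]
    exact hfar p (Or.inr ⟨_, ⟨dist_nonneg, le_rfl⟩, hγ.target⟩)
  have hq : n < dist (α t) q := hfar q (Or.inl ⟨_, ⟨le_rfl, dist_nonneg⟩, hβ.source⟩)
  rw [hα.dist_source ht] at hp
  rw [hα.dist_target ht] at hq
  have s1 : IsGeodesicSegment (fun s => α (t - s)) (α t) p := by
    have := isGeodesicSegment_of_isometric_neg ht.1 (c := α) fun s hs r hr =>
      hα.isometric s ⟨hs.1, hs.2.trans ht.2⟩ r ⟨hr.1, hr.2.trans ht.2⟩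
    rwa [hα.source] at this
  have s2 : IsGeodesicSegment (fun s => α (t + s)) (α t) q := by
    have := (isGeodesicSegment_of_isometric ht.2 (c := α) fun s hs r hr =>
      hα.isometric s ⟨ht.1.trans hs.1, hs.2⟩ r ⟨ht.1.trans hr.1, hr.2⟩).2
    rwa [hα.target] at this
  obtain ⟨ρ, hρ⟩ := hX.geodesic (α t) r
  -- The two directions of the side are so far apart that `ρ` diverges from at least one.
  have h2 : dist (α (t - 1)) (α (t + 1)) = 2 := by
    rw [hα.isometric _ ⟨by linarith, by linarith⟩ _ ⟨by linarith, by linarith⟩]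
    rw [show t - 1 - (t + 1) = -2 by ring]
    norm_num
  have h3 := dist_triangle_right (α (t - 1)) (α (t + 1)) (ρ 1)
  have fβ : ∀ s ∈ Set.Icc 0 (dist q r), n < dist (α t) (β s) :=
    fun s hs => hfar _ (Or.inl ⟨s, hs, rfl⟩)
  have fγ : ∀ s ∈ Set.Icc 0 (dist p r), n < dist (α t) (γ (dist r p - s)) := by
    intro s hs
    rw [dist_comm p r] at hs
    exact hfar _ (Or.inr ⟨_, ⟨by linarith [hs.2], by linarith [hs.1]⟩, rfl⟩)
  rcases le_total 1 (dist (α (t - 1)) (ρ 1)) with h | h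
  · obtain ⟨u, v, α', ρ', H⟩ := hX.exists_nonobtuse hn s1 hρ hγ.reverse fγ h
    exact ⟨_, u, v, α', ρ', H⟩
  · obtain ⟨u, v, α', ρ', H⟩ := hX.exists_nonobtuse hn s2 hρ hβ fβ (by linarith)
    exact ⟨_, u, v, α', ρ', H⟩

/-- The comparison inequality in terms of the slope of the distance to `v`. -/
theorem dist_sq_le_of_slope (hX : IsCAT0 X) {p q v : X} {α τ : ℝ → X}
    (hα : IsGeodesicSegment α p q) (hτ : IsGeodesicSegment τ p v) (hq : 0 < dist p q)
    (hv : 0 < dist p v) {s t : ℝ} (hs : s ∈ Set.Icc 0 (dist p q))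
    (ht : t ∈ Set.Icc 0 (dist p v)) :
    dist (α s) (τ t) ^ 2 ≤ s ^ 2 + t ^ 2 + 2 * s * t * ((dist q v - dist p v) / dist p q) := by
  refine (hX.dist_sq_le_of_mem hα hτ hs ht hq hv).trans ?_
  set Δ := dist q v - dist p v with hΔ
  have h0 : |Δ| ≤ dist p q := by rw [dist_comm p q]; exact abs_dist_sub_le _ _ _
  have h1 : Δ ^ 2 ≤ dist p q ^ 2 := sq_le_sq' (abs_le.1 h0).1 (abs_le.1 h0).2
  have h2 : -(2 * (Δ / dist p q)) ≤
      (dist p q ^ 2 + dist p v ^ 2 - dist q v ^ 2) / (dist p q * dist p v) := by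
    rw [le_div_iff₀ (by positivity)]
    have : -(2 * (Δ / dist p q)) * (dist p q * dist p v) = -(2 * Δ * dist p v) := by field_simp
    rw [this, show dist q v = dist p v + Δ by rw [hΔ]; ring]
    linarith
  have h3 := mul_le_mul_of_nonneg_left h2 (mul_nonneg hs.1 ht.1)
  linarith

/-- The distance to `v` is midpoint convex along a path which is isometric on `[u, w]`. -/
theorem two_mul_dist_le (hX : IsCAT0 X) {c : ℝ → X} {u r w : ℝ} (h : u < r) (hr : w - r = r - u)
    (hc : ∀ s ∈ Set.Icc u w, ∀ t ∈ Set.Icc u w, dist (c s) (c t) = |s - t|) (v : X) :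
    2 * dist (c r) v ≤ dist (c u) v + dist (c w) v := by
  have key := hX.dist_sq_le_path h.le (by linarith) hc v
  have h1 : |dist (c u) v - dist (c w) v| ≤ w - u := by
    refine (abs_dist_sub_le _ _ _).trans (le_of_eq ?_)
    rw [hc _ ⟨le_rfl, by linarith⟩ _ ⟨by linarith, le_rfl⟩, abs_sub_comm,
      abs_of_nonneg (by linarith)]
  rw [dist_comm v, dist_comm v, dist_comm v] at key
  have h2 : (dist (c u) v - dist (c w) v) ^ 2 ≤ (w - u) ^ 2 :=
    sq_le_sq' (abs_le.1 h1).1 (abs_le.1 h1).2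
  obtain rfl : w = 2 * r - u := by linarith
  have h3 : dist (c r) v ^ 2 ≤ 1 / 2 * dist (c u) v ^ 2 + 1 / 2 * dist (c (2 * r - u)) v ^ 2
      - (r - u) ^ 2 := by
    refine le_of_mul_le_mul_left (a := 2 * (r - u)) ?_ (by linarith)
    linarith
  refine abs_le_of_sq_le_sq' ?_ (add_nonneg dist_nonneg dist_nonneg) |>.2
  linarith

/-- A geodesic along which the distance to some far away point `v` changes almost linearly. -/
theorem exists_slopes_close (hX : IsCAT0 X) (hh : ¬ IsHyperbolicSpace X) {N : ℕ} (hN : 1 ≤ N) :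
    ∃ (σ : ℝ → X) (v : X),
      (∀ s ∈ Set.Icc (-N : ℝ) N, ∀ t ∈ Set.Icc (-N : ℝ) N, dist (σ s) (σ t) = |s - t|) ∧
      N ≤ dist (σ 0) v ∧
      (dist (σ N) v - dist (σ 0) v) - (dist (σ 0) v - dist (σ (-N)) v) ≤ 1 ∧
      dist (σ N) v - dist (σ 0) v ≤ N / 2 ∧ -7 / 8 * N ≤ dist (σ N) v - dist (σ 0) v := by
  set k : ℕ := 6 * N + 2 with hk
  have hN' : (1 : ℝ) ≤ N := by exact_mod_cast hN
  have hkN : 1 ≤ (k : ℝ) * N := by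
    have : (1 : ℝ) ≤ k := by exact_mod_cast (by omega : 1 ≤ k)
    nlinarith
  -- The square keeps the distance to `v` from rising by more than `1 / 2` over `k` steps; the other
  -- terms make room for these steps and leave `v` at distance `N`.
  set n : ℝ := ((k : ℝ) * N) ^ 2 + k * N + N with hn
  have hkn : (k : ℝ) * N ≤ n := by
    have : 0 ≤ ((k : ℝ) * N) ^ 2 := sq_nonneg _
    linarith
  obtain ⟨x, u, v, α, ρ, hα, hρ, hu, hv, hdiv, hobt⟩ := hX.exists_fat hh (hkN.trans hkn)
  have hmem : ∀ i : ℕ, i ≤ k → (i : ℝ) * N ∈ Set.Icc 0 (dist x u) := by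
    intro i hi
    have : (i : ℝ) * N ≤ k * N := by gcongr
    exact ⟨by positivity, by linarith⟩
  have hD0 : 0 < dist x v := by linarith
  have hu0 : 0 < dist x u := by linarith
  have hiso : ∀ i : ℕ, i + 2 ≤ k → ∀ s ∈ Set.Icc ((i : ℝ) * N) ((i + 2 : ℕ) * N),
      ∀ t ∈ Set.Icc ((i : ℝ) * N) ((i + 2 : ℕ) * N), dist (α s) (α t) = |s - t| :=
    fun i hi s hs t ht => hα.isometric s
      ⟨(hmem i (by omega)).1.trans hs.1, hs.2.trans (hmem _ hi).2⟩ t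
      ⟨(hmem i (by omega)).1.trans ht.1, ht.2.trans (hmem _ hi).2⟩
  set g : ℕ → ℝ := fun i => dist (α (i * N)) v with hg
  have hslopes : ∃ i, i + 2 ≤ 6 * N + 2 ∧ (g (i + 2) - g (i + 1)) - (g (i + 1) - g i) ≤ 1 ∧
      g (i + 2) - g (i + 1) ≤ N / 2 ∧ -7 / 8 * N ≤ g (i + 2) - g (i + 1) := by
    refine _root_.exists_slopes_close hN ?_ ?_ ?_
    · have h1 := hmem 1 (by omega)
      rw [Nat.cast_one, one_mul] at h1
      have e := hα.dist_source h1
      have := hX.dist_sq_le_of_mem (hα.initial h1) hρ (s := 1) (t := 1)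
        ⟨zero_le_one, by rw [e]; exact hN'⟩ ⟨zero_le_one, by linarith⟩ (by rw [e]; linarith) hD0
      rw [e] at this
      have h2 : (1 / 2 : ℝ) ^ 2 ≤ dist (α 1) (ρ 1) ^ 2 := pow_le_pow_left₀ (by norm_num) hdiv 2
      -- Divergence by `1 / 2` at time `1` gives `1 / 4 ≤ 2 - 2 cos`, the source of the slope bound
      -- `-7 / 8`.
      have h3 : ((N : ℝ) ^ 2 + dist x v ^ 2 - dist (α N) v ^ 2) / (N * dist x v) ≤ 7 / 4 := by
        linarith
      rw [div_le_iff₀ (by positivity)] at h3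
      simp only [hg, Nat.cast_zero, zero_mul, hα.source, Nat.cast_one, one_mul]
      refine abs_le_of_sq_le_sq' ?_ dist_nonneg |>.2
      have h4 : 0 ≤ (N : ℝ) ^ 2 := sq_nonneg _
      linarith
    · intro i hi
      have h1 := hmem i hi
      have := hX.dist_sq_le_of_mem hα hρ h1 (t := dist x v) ⟨hD0.le, le_rfl⟩ hu0 hD0
      rw [hρ.target] at this
      have h2 : 0 ≤ (i : ℝ) * N * dist x v *
          ((dist x u ^ 2 + dist x v ^ 2 - dist u v ^ 2) / (dist x u * dist x v)) := by
        have : 0 ≤ dist x u ^ 2 + dist x v ^ 2 - dist u v ^ 2 := by linarith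
        positivity
      have h3 : ((i : ℝ) * N) ^ 2 ≤ ((k : ℝ) * N) ^ 2 := by
        have : (i : ℝ) ≤ k := by exact_mod_cast hi
        gcongr
      simp only [hg, Nat.cast_zero, zero_mul, hα.source]
      refine abs_le_of_sq_le_sq' ?_ (by linarith) |>.2
      linarith
    · intro i hi
      have hN0 : (0 : ℝ) < N := by linarith
      refine hX.two_mul_dist_le (c := α) ?_ ?_ (hiso i hi) v
      · push_cast; linarith
      · push_cast; ring
  obtain ⟨i, hik, hi1, hi2, hi3⟩ := hslopes
  simp only [hg] at hi1 hi2 hi3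
  set T : ℝ := (i + 1 : ℕ) * N with hT
  have e0 : (i : ℕ) * (N : ℝ) = T - N := by rw [hT]; push_cast; ring
  have e2 : (i + 2 : ℕ) * (N : ℝ) = T + N := by rw [hT]; push_cast; ring
  have hiso := hiso i hik
  rw [e0, e2] at hiso hi1
  rw [e2] at hi2 hi3
  refine ⟨fun s => α (T + s), v, fun s hs t ht => ?_, ?_, ?_, ?_, ?_⟩
  · rw [hiso _ ⟨by linarith [hs.1], by linarith [hs.2]⟩ _
      ⟨by linarith [ht.1], by linarith [ht.2]⟩, add_sub_add_left_eq_sub]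
  · have h1 := dist_triangle x (α T) v
    rw [hα.dist_source (hmem (i + 1) (by omega))] at h1
    have h2 : T ≤ k * N := by
      have : ((i + 1 : ℕ) : ℝ) ≤ k := by exact_mod_cast (by omega : i + 1 ≤ k)
      rw [hT]; gcongr
    have h3 : 0 ≤ ((k : ℝ) * N) ^ 2 := sq_nonneg _
    simp only [add_zero]
    linarith
  · simp only [add_zero, ← sub_eq_add_neg]; exact hi1
  · simp only [add_zero]; exact hi2
  · simp only [add_zero]; exact hi3

/-- A large piece of an approximate flat half plane. -/
theorem exists_approx_halfPlane (hX : IsCAT0 X) (hh : ¬ IsHyperbolicSpace X) {N : ℕ}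
    (hN : 1 ≤ N) : ∃ (σ τ : ℝ → X) (q : ℝ), q ∈ Set.Icc (-7 / 8 : ℝ) (1 / 2) ∧ τ 0 = σ 0 ∧
      (∀ s ∈ Set.Icc (-N : ℝ) N, ∀ t ∈ Set.Icc (-N : ℝ) N, dist (σ s) (σ t) = |s - t|) ∧
      (∀ s ∈ Set.Icc (0 : ℝ) N, ∀ t ∈ Set.Icc (0 : ℝ) N, dist (τ s) (τ t) = |s - t|) ∧
      ∀ s ∈ Set.Icc (-N : ℝ) N, ∀ t ∈ Set.Icc (0 : ℝ) N,
        dist (σ s) (τ t) ^ 2 ≤ s ^ 2 + t ^ 2 + 2 * q * s * t + 2 * |s| * t / N := by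
  obtain ⟨σ, v, hσ, ha, h1, h2, h3⟩ := hX.exists_slopes_close hh hN
  have hN0 : (0 : ℝ) < N := by exact_mod_cast hN
  have ha0 := hN0.trans_le ha
  obtain ⟨τ, hτ⟩ := hX.geodesic (σ 0) v
  have s1 := isGeodesicSegment_of_isometric_neg (u := -N) (v := 0) (by linarith) (c := σ)
    fun s hs r hr => hσ s ⟨hs.1, hs.2.trans hN0.le⟩ r ⟨hr.1, hr.2.trans hN0.le⟩
  obtain ⟨d2, s2⟩ := isGeodesicSegment_of_isometric (u := 0) (v := N) hN0.le (c := σ)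
    fun s hs r hr => hσ s ⟨by linarith [hs.1], hs.2⟩ r ⟨by linarith [hr.1], hr.2⟩
  have d1 : dist (σ 0) (σ (-N)) = N := by
    rw [hσ _ ⟨by linarith, hN0.le⟩ _ ⟨le_rfl, by linarith⟩]; simp
  rw [sub_zero] at d2
  refine ⟨σ, τ, (dist (σ N) v - dist (σ 0) v) / N, ⟨?_, ?_⟩, hτ.source, hσ, ?_, ?_⟩
  · rw [le_div_iff₀ hN0]; exact h3
  · rw [div_le_iff₀ hN0]; linarith
  · intro s hs t ht
    exact hτ.isometric s ⟨hs.1, hs.2.trans ha⟩ t ⟨ht.1, ht.2.trans ha⟩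
  · intro s hs t ht
    rcases le_total 0 s with h0 | h0
    · have := hX.dist_sq_le_of_slope s2 hτ (s := s) (t := t) (by rw [d2]; exact hN0) ha0
        ⟨h0, by rw [d2]; exact hs.2⟩ ⟨ht.1, ht.2.trans ha⟩
      rw [d2, zero_add] at this
      have h4 : 0 ≤ 2 * |s| * t / N := by have := ht.1; positivity
      linarith
    · have := hX.dist_sq_le_of_slope s1 hτ (s := -s) (t := t) (by rw [d1]; exact hN0) ha0
        ⟨by linarith, by rw [d1]; linarith [hs.1]⟩ ⟨ht.1, ht.2.trans ha⟩
      rw [d1, zero_sub, neg_neg] at this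
      -- On the backward half the slope differs from `q` by at most `1 / N`, whence the error term.
      have h4 := mul_le_mul_of_nonneg_right h1
        (div_nonneg (mul_nonneg (mul_nonneg zero_le_two (neg_nonneg.2 h0)) ht.1) hN0.le)
      rw [abs_of_nonpos h0]
      refine this.trans (le_of_sub_nonneg ?_)
      refine (sub_nonneg.2 h4).trans (le_of_eq ?_)
      field_simp
      ring

end IsCAT0

theorem eventually_mem_Icc_natCast (r : ℝ) :
    ∀ᶠ n : ℕ in atTop, r ∈ Set.Icc (-((n + 1 : ℕ) : ℝ)) ((n + 1 : ℕ) : ℝ) := by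
  filter_upwards [tendsto_natCast_atTop_atTop.eventually_ge_atTop |r|] with n hn
  push_cast
  have := abs_le.1 (hn.trans (by linarith : (n : ℝ) ≤ n + 1))
  exact this

/-- A cocompact `CAT(0)` space that is not hyperbolic contains a line and a ray whose distances are
those in a Euclidean half plane. -/
theorem IsGeometricAction.exists_line_ray {G X : Type*} [Group G] [MetricSpace X] [MulAction G X]
    [ProperSpace X] (hG : IsGeometricAction G X) (hX : IsCAT0 X) (hh : ¬ IsHyperbolicSpace X) :
    ∃ (σ τ : ℝ → X) (q : ℝ), q ∈ Set.Icc (-7 / 8 : ℝ) (1 / 2) ∧ Isometry σ ∧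
      (∀ s, 0 ≤ s → ∀ t, 0 ≤ t → dist (τ s) (τ t) = |s - t|) ∧
      ∀ s t, 0 ≤ t → dist (σ s) (τ t) ^ 2 = s ^ 2 + t ^ 2 + 2 * q * s * t := by
  choose σ τ q hq h0 hσ hτ hστ using fun n : ℕ =>
    hX.exists_approx_halfPlane hh (N := n + 1) (by omega)
  have hIcc : ∀ t : ℝ, 0 ≤ t → ∀ᶠ n : ℕ in atTop, t ∈ Set.Icc (0 : ℝ) ((n + 1 : ℕ) : ℝ) :=
    fun t ht => (eventually_mem_Icc_natCast t).mono fun n hn => ⟨ht, hn.2⟩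
  obtain ⟨φ, hφ⟩ := hG.exists_limit_map
    (fun n => Sum.elim (σ n) (fun t => τ n (max t 0))) (Sum.inl 0)
    (Sum.elim (fun s => |s|) (fun t => max t 0)) (by
      rintro (s | t)
      · filter_upwards [eventually_mem_Icc_natCast s, eventually_mem_Icc_natCast 0] with n h1 h2
        simp [hσ n s h1 0 h2]
      · filter_upwards [hIcc _ (le_max_right t 0), hIcc 0 le_rfl] with n h1 h2
        simp only [Sum.elim_inl, Sum.elim_inr]
        rw [← h0 n, hτ n _ h1 0 h2, sub_zero, abs_of_nonneg (le_max_right _ _)])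
  have hmono : (hyperfilter ℕ : Filter ℕ) ≤ atTop := Nat.hyperfilter_le_atTop
  obtain ⟨q₀, hq₀, hlim⟩ := (isCompact_Icc (a := (-7 / 8 : ℝ)) (b := 1 / 2)).ultrafilter_le_nhds
    ((hyperfilter ℕ).map q) (by
      rw [le_principal_iff]
      change ∀ᶠ n in (hyperfilter ℕ : Filter ℕ), q n ∈ Set.Icc (-7 / 8 : ℝ) (1 / 2)
      exact Eventually.of_forall hq)
  have hlim : Tendsto q (hyperfilter ℕ : Filter ℕ) (𝓝 q₀) := hlim
  have hσφ : Isometry fun s => φ (Sum.inl s) := by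
    refine Isometry.of_dist_eq fun s t => tendsto_nhds_unique (hφ _ _) ?_
    refine (tendsto_const_nhds (x := dist s t)).congr' (Eventually.filter_mono hmono ?_)
    filter_upwards [eventually_mem_Icc_natCast s, eventually_mem_Icc_natCast t] with n h1 h2
    rw [Real.dist_eq]
    exact (hσ n s h1 t h2).symm
  have hτφ : ∀ s, 0 ≤ s → ∀ t, 0 ≤ t → dist (φ (Sum.inr s)) (φ (Sum.inr t)) = |s - t| := by
    intro s hs t ht
    refine tendsto_nhds_unique (hφ _ _) ?_
    refine tendsto_const_nhds.congr' (Eventually.filter_mono hmono ?_)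
    filter_upwards [hIcc s hs, hIcc t ht] with n h1 h2
    simp only [Sum.elim_inr, max_eq_left hs, max_eq_left ht]
    exact (hτ n s h1 t h2).symm
  have hle : ∀ s t, 0 ≤ t →
      dist (φ (Sum.inl s)) (φ (Sum.inr t)) ^ 2 ≤ s ^ 2 + t ^ 2 + 2 * q₀ * s * t := by
    intro s t ht
    have hz : Tendsto (fun n : ℕ => 2 * |s| * t / ((n + 1 : ℕ) : ℝ)) (hyperfilter ℕ : Filter ℕ)
        (𝓝 0) := ((tendsto_add_atTop_iff_nat 1).2
          (tendsto_const_div_atTop_nhds_zero_nat (2 * |s| * t))).mono_left hmono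
    have hr : Tendsto (fun n : ℕ => s ^ 2 + t ^ 2 + 2 * q n * s * t
        + 2 * |s| * t / ((n + 1 : ℕ) : ℝ)) (hyperfilter ℕ : Filter ℕ)
        (𝓝 (s ^ 2 + t ^ 2 + 2 * q₀ * s * t + 0)) :=
      ((((hlim.const_mul 2).mul_const s).mul_const t).const_add _).add hz
    rw [add_zero] at hr
    refine le_of_tendsto_of_tendsto ((hφ _ _).pow 2) hr (Eventually.filter_mono hmono ?_)
    filter_upwards [eventually_mem_Icc_natCast s, hIcc t ht] with n h1 h2
    simp only [Sum.elim_inl, Sum.elim_inr, max_eq_left ht]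
    exact hστ n s h1 t h2
  have h00 : φ (Sum.inr 0) = φ (Sum.inl 0) := by
    have := hle 0 0 le_rfl
    have h1 : dist (φ (Sum.inl 0)) (φ (Sum.inr 0)) ^ 2 = 0 :=
      le_antisymm (by simpa using this) (sq_nonneg _)
    exact (dist_eq_zero.1 (pow_eq_zero_iff two_ne_zero |>.1 h1)).symm
  refine ⟨_, fun t => φ (Sum.inr t), q₀, hq₀, hσφ, hτφ, fun s t ht => ?_⟩
  -- Line and ray share their origin, so the upper bound is attained at `s = 0` and rigidity
  -- applies.
  have := hX.dist_sq_eq_of_touch_line hσφ (φ (Sum.inr t)) (m := 2 * q₀ * t) (n := t ^ 2)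
    (r₀ := 0) (fun r => ?_) ?_ s
  · rw [dist_comm, this]; ring
  · rw [dist_comm]
    exact (hle r t ht).trans (le_of_eq (by ring))
  · simp only [← h00]
    rw [hτφ t ht 0 le_rfl, sq_abs]; ring

/-- A lower bound for the distance of two points in terms of their distances to far away points. -/
theorem sub_le_dist_of_asymptotic {X : Type*} [MetricSpace X] {p p' : X} {τ : ℝ → X}
    {x x' e e' r₀ : ℝ} (he : 0 ≤ e) (he' : 0 ≤ e')
    (h : ∀ r, r₀ ≤ r → dist p (τ r) ^ 2 = (r - x) ^ 2 + e)
    (h' : ∀ r, r₀ ≤ r → dist p' (τ r) ^ 2 = (r - x') ^ 2 + e') : x' - x ≤ dist p p' := by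
  by_contra! hc
  set η := x' - x - dist p p' with hη
  have hη0 : 0 < η := by linarith
  -- Far out, the transverse offset `e'` adds at most `e' / (2 * w)` to the distance, less than the
  -- supposed gap `η`.
  set w := max (r₀ - x') (e' / η + 1) with hw
  have hw1 : r₀ - x' ≤ w := le_max_left _ _
  have hw2 : e' / η + 1 ≤ w := le_max_right _ _
  have hw0 : 0 < w := by
    have : 0 ≤ e' / η := by positivity
    linarith
  have h1 := h (w + x') (by linarith)
  have h2 := h' (w + x') (by linarith)
  have h3 : w + x' - x ≤ dist p (τ (w + x')) :=
    abs_le_of_sq_le_sq' (by linarith) dist_nonneg |>.2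
  have h4 : dist p' (τ (w + x')) ≤ w + e' / (2 * w) := by
    refine abs_le_of_sq_le_sq' ?_ (by positivity) |>.2
    rw [h2, add_sub_cancel_right]
    have : (w + e' / (2 * w)) ^ 2 = w ^ 2 + e' + (e' / (2 * w)) ^ 2 := by field_simp; ring
    rw [this]
    nlinarith [sq_nonneg (e' / (2 * w))]
  have h5 := dist_triangle p p' (τ (w + x'))
  have h6 : η ≤ e' / (2 * w) := by linarith
  rw [le_div_iff₀ (by positivity)] at h6
  have h7 : e' < η * w := by
    have : e' / η < w := by linarith
    rwa [div_lt_iff₀ hη0, mul_comm] at this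
  nlinarith

namespace IsCAT0

variable {X : Type*} [MetricSpace X]

theorem exists_midpoint (hX : IsCAT0 X) (x y : X) : ∃ m, dist x m = dist x y / 2 ∧
    dist y m = dist x y / 2 ∧
    ∀ z, dist z m ^ 2 ≤ dist z x ^ 2 / 2 + dist z y ^ 2 / 2 - dist x y ^ 2 / 4 := by
  obtain ⟨γ, hγ⟩ := hX.geodesic x y
  have hm : dist x y / 2 ∈ Set.Icc 0 (dist x y) := by
    have : 0 ≤ dist x y := dist_nonneg
    exact ⟨by linarith, by linarith⟩
  refine ⟨γ (dist x y / 2), hγ.dist_source hm, ?_, fun z => ?_⟩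
  · rw [dist_comm, hγ.dist_target hm]; ring
  · have := hX.dist_sq_le_segment hγ z (l := 1 / 2) ⟨by norm_num, by norm_num⟩
    rw [one_div_mul_eq_div] at this
    linarith

/-- The line and the ray span a flat half plane. -/
theorem exists_halfPlane (hX : IsCAT0 X) {σ τ : ℝ → X} {q : ℝ} (hq : q ^ 2 ≤ 1) (hσ : Isometry σ)
    (hτ : ∀ s, 0 ≤ s → ∀ t, 0 ≤ t → dist (τ s) (τ t) = |s - t|)
    (hστ : ∀ s t, 0 ≤ t → dist (σ s) (τ t) ^ 2 = s ^ 2 + t ^ 2 + 2 * q * s * t) :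
    ∃ φ : ℝ → ℝ → X, ∀ a b a' b', 0 < b → 0 < b' → dist (φ a b) (φ a' b') ^ 2 =
      (a - a') ^ 2 + (b - b') ^ 2 - 2 * q * (a - a') * (b - b') := by
  -- `φ a b` has oblique coordinates `(a, b)` along `σ` and `τ`, whose unit vectors have inner
  -- product `-q`.
  choose φ hφ1 hφ2 hφ3 using fun a b : ℝ => hX.exists_midpoint (σ (2 * a)) (τ (2 * b))
  have hφσ : ∀ a b, 0 < b → ∀ r,
      dist (φ a b) (σ r) ^ 2 = (r - (a - q * b)) ^ 2 + (1 - q ^ 2) * b ^ 2 := by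
    intro a b hb r
    have hb2 : 0 ≤ 2 * b := by linarith
    have := hX.dist_sq_eq_of_touch_line hσ (φ a b) (m := 2 * q * b - 2 * a)
      (n := a ^ 2 + b ^ 2 - 2 * q * a * b) (r₀ := 2 * a) (fun r => ?_) ?_ r
    · rw [this]; ring
    · have := hφ3 a b (σ r)
      rw [hστ _ _ hb2, hστ _ _ hb2, hσ.dist_eq, Real.dist_eq, sq_abs] at this
      rw [dist_comm]
      linarith
    · rw [dist_comm, hφ1, div_pow, hστ _ _ hb2]
      ring
  have hφτ : ∀ a b, 0 < b → ∀ r, 0 ≤ r →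
      dist (φ a b) (τ r) ^ 2 = (r - (b - q * a)) ^ 2 + (1 - q ^ 2) * a ^ 2 := by
    intro a b hb r hr
    have hb2 : 0 ≤ 2 * b := by linarith
    have hup : ∀ r, 0 ≤ r → dist (φ a b) (τ r) ^ 2 ≤
        r ^ 2 + (2 * q * a - 2 * b) * r + (a ^ 2 + b ^ 2 - 2 * q * a * b) := by
      intro r hr
      have := hφ3 a b (τ r)
      rw [dist_comm (τ r) (σ _), hστ _ _ hb2, hστ _ _ hr, hτ _ hr _ hb2, sq_abs] at this
      rw [dist_comm]
      linarith
    have htouch : dist (φ a b) (τ (2 * b)) ^ 2 =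
        (2 * b) ^ 2 + (2 * q * a - 2 * b) * (2 * b) + (a ^ 2 + b ^ 2 - 2 * q * a * b) := by
      rw [dist_comm, hφ2, div_pow, hστ _ _ hb2]
      ring
    have hiso : ∀ u v : ℝ, 0 ≤ u → ∀ s ∈ Set.Icc u v, ∀ t ∈ Set.Icc u v,
        dist (τ s) (τ t) = |s - t| :=
      fun u v hu s hs t ht => hτ s (hu.trans hs.1) t (hu.trans ht.1)
    have : dist (φ a b) (τ r) ^ 2 =
        r ^ 2 + (2 * q * a - 2 * b) * r + (a ^ 2 + b ^ 2 - 2 * q * a * b) := by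
      rcases lt_trichotomy r (2 * b) with h | h | h
      · exact (hX.dist_sq_eq_of_touch h (lt_add_one _) (hiso _ _ hr) _ (hup r hr)
          (hup _ (by linarith)) htouch).1
      · rw [h, htouch]
      · exact (hX.dist_sq_eq_of_touch (u := 0) (by linarith) h (hiso _ _ le_rfl) _ (hup 0 le_rfl)
          (hup r hr) htouch).2
    rw [this]; ring
  have hup : ∀ a b a' b', 0 < b → 0 < b' → dist (φ a b) (φ a' b') ^ 2 ≤
      (a - a') ^ 2 + (b - b') ^ 2 - 2 * q * (a - a') * (b - b') := by
    intro a b a' b' hb hb'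
    have := hφ3 a' b' (φ a b)
    rw [hφσ a b hb, hφτ a b hb _ (by linarith), hστ _ _ (by linarith)] at this
    linarith
  have hhor : ∀ b, 0 < b → Isometry fun a => φ a b := by
    intro b hb
    have hlow : ∀ a a', a' - a ≤ dist (φ a b) (φ a' b) := by
      intro a a'
      have he : 0 ≤ (1 - q ^ 2) * b ^ 2 := mul_nonneg (by linarith) (sq_nonneg _)
      have := sub_le_dist_of_asymptotic (r₀ := 0) he he (fun r _ => hφσ a b hb r)
        (fun r _ => hφσ a' b hb r)
      linarith
    refine Isometry.of_dist_eq fun a a' => le_antisymm ?_ ?_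
    · refine abs_le_of_sq_le_sq ?_ dist_nonneg |>.trans' (le_abs_self _)
      rw [Real.dist_eq, sq_abs]
      exact (hup a b a' b hb hb).trans (le_of_eq (by ring))
    · rw [Real.dist_eq, abs_le']
      exact ⟨by rw [dist_comm]; exact hlow a' a, by rw [neg_sub]; exact hlow a a'⟩
  have hver : ∀ a b b', 0 < b → 0 < b' → dist (φ a b) (φ a b') ^ 2 = (b - b') ^ 2 := by
    have hlow : ∀ a b b', 0 < b → 0 < b' → b' - b ≤ dist (φ a b) (φ a b') := by
      intro a b b' hb hb'
      have he : 0 ≤ (1 - q ^ 2) * a ^ 2 := mul_nonneg (by linarith) (sq_nonneg _)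
      have := sub_le_dist_of_asymptotic (r₀ := 0) he he (hφτ a b hb) (hφτ a b' hb')
      linarith
    intro a b b' hb hb'
    refine le_antisymm ((hup a b a b' hb hb').trans (le_of_eq (by ring))) ?_
    rw [sq_le_sq, abs_of_nonneg (dist_nonneg (x := φ a b)), abs_le']
    exact ⟨by rw [dist_comm]; exact hlow a b' b hb' hb, by rw [neg_sub]; exact hlow a b b' hb hb'⟩
  refine ⟨φ, fun a b a' b' hb hb' => ?_⟩
  -- On the horizontal line at height `b'` the upper bound is attained at the point with the same
  -- `a`, so rigidity gives the rest.
  have := hX.dist_sq_eq_of_touch_line (hhor b' hb') (φ a b) (m := 2 * q * (b - b') - 2 * a)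
    (n := a ^ 2 + (b - b') ^ 2 - 2 * q * a * (b - b')) (r₀ := a) (fun r => ?_) ?_ a'
  · rw [this]; ring
  · exact (hup a b r b' hb hb').trans (le_of_eq (by ring))
  · rw [hver a b b' hb hb']; ring

end IsCAT0

/-- The flat plane theorem. -/
theorem IsGeometricAction.exists_isFlat {G X : Type*} [Group G] [MetricSpace X] [MulAction G X]
    [ProperSpace X] (hG : IsGeometricAction G X) (hX : IsCAT0 X) (hh : ¬ IsHyperbolicSpace X) :
    ∃ F : Set X, IsFlat F := by
  obtain ⟨σ, τ, q, hq, hσ, hτ, hστ⟩ := hG.exists_line_ray hX hh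
  have hq2 : q ^ 2 < 1 := by nlinarith [hq.1, hq.2]
  obtain ⟨φ, hφ⟩ := hX.exists_halfPlane hq2.le hσ hτ hστ
  have hsqrt : ∀ a b a' b', 0 < b → 0 < b' → dist (φ a b) (φ a' b') =
      √((a - a') ^ 2 + (b - b') ^ 2 - 2 * q * (a - a') * (b - b')) := by
    intro a b a' b' hb hb'
    rw [← hφ a b a' b' hb hb', Real.sqrt_sq dist_nonneg]
  have hev : ∀ b : ℝ, ∀ᶠ n : ℕ in atTop, 0 < b + n := fun b =>
    (tendsto_natCast_atTop_atTop.eventually_gt_atTop (-b)).mono fun n hn => by linarith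
  have hdist : ∀ s t : ℝ × ℝ, ∀ᶠ n : ℕ in atTop,
      √((s.1 - t.1) ^ 2 + (s.2 - t.2) ^ 2 - 2 * q * (s.1 - t.1) * (s.2 - t.2)) =
      dist (φ s.1 (s.2 + n)) (φ t.1 (t.2 + n)) := by
    intro s t
    filter_upwards [hev s.2, hev t.2] with n h1 h2
    rw [hsqrt _ _ _ _ h1 h2, add_sub_add_right_eq_sub]
  -- Any two points of the plane lie in the half plane once raised by a large `n`, and raising
  -- preserves their distance.
  obtain ⟨Φ, hΦ⟩ := hG.exists_limit_map (fun n (s : ℝ × ℝ) => φ s.1 (s.2 + n)) (0, 0) _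
    fun s => (hdist s (0, 0)).mono fun n hn => hn.ge
  have hΦd : ∀ s t : ℝ × ℝ, dist (Φ s) (Φ t) =
      √((s.1 - t.1) ^ 2 + (s.2 - t.2) ^ 2 - 2 * q * (s.1 - t.1) * (s.2 - t.2)) := fun s t =>
    tendsto_nhds_unique (hΦ s t) (tendsto_const_nhds.congr'
      ((hdist s t).filter_mono Nat.hyperfilter_le_atTop))
  set κ := √(1 - q ^ 2) with hκ
  have hκ0 : 0 < κ := Real.sqrt_pos.2 (by linarith)
  have hκ2 : κ ^ 2 = 1 - q ^ 2 := Real.sq_sqrt (by linarith)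
  refine ⟨_, 2, le_rfl, fun w : EuclideanSpace ℝ (Fin 2) => Φ (w 0 + q * (w 1 / κ), w 1 / κ),
    Isometry.of_dist_eq fun v w => ?_, rfl⟩
  rw [hΦd, EuclideanSpace.dist_eq, Fin.sum_univ_two, Real.dist_eq, Real.dist_eq, sq_abs, sq_abs]
  congr 1
  obtain ⟨y, hy⟩ : ∃ y, v 1 = κ * y := ⟨v 1 / κ, by field_simp⟩
  obtain ⟨y', hy'⟩ : ∃ y', w 1 = κ * y' := ⟨w 1 / κ, by field_simp⟩
  simp only [hy, hy', mul_div_cancel_left₀ _ hκ0.ne', ← mul_sub, mul_pow, hκ2]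
  ring

/-! ### From translations to `ℤ × ℤ` -/

open Pointwise

namespace IsCrystallographic

variable {Γ E : Type*} [Group Γ] [NormedAddCommGroup E] [InnerProductSpace ℝ E]
  {A : Γ → E →L[ℝ] E} {a : Γ → E}

/-- The homomorphism taking a translation to its translation vector. -/
theorem exists_translationHom (h : IsCrystallographic A a) :
    ∃ (T : Subgroup Γ) (t : T →* Multiplicative E), (∀ g, g ∈ T ↔ A g = 1) ∧
      ∀ g : T, (t g).toAdd = a g := by
  let Ahom : Γ →* (E →L[ℝ] E) := ⟨⟨A, h.linear_one⟩, h.linear_mul⟩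
  refine ⟨Ahom.ker, MonoidHom.mk' (fun g => Multiplicative.ofAdd (a g)) fun g k => ?_,
    fun g => MonoidHom.mem_ker, fun g => rfl⟩
  rw [← ofAdd_add]
  congr 1
  have : A (g : Γ) = 1 := g.2
  rw [Subgroup.coe_mul, h.trans_mul, this, add_comm]
  rfl

/-- A group acting properly and coboundedly on a Euclidean space of dimension at least two
contains `ℤ × ℤ`. -/
theorem exists_injective [FiniteDimensional ℝ E] (h : IsCrystallographic A a)
    (hE : 2 ≤ Module.finrank ℝ E) :
    ∃ φ : Multiplicative (ℤ × ℤ) →* Γ, Function.Injective φ := by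
  obtain ⟨g, k, hg, hk, hind⟩ := h.exists_translations hE
  obtain ⟨T, t, hT, ht⟩ := h.exists_translationHom
  lift g to T using (hT g).2 hg
  lift k to T using (hT k).2 hk
  rw [← ht, ← ht] at hind
  have hker : {x : T | t x = 1}.Finite := by
    refine ((h.finite 0).preimage (f := ((↑) : T → Γ)) Subtype.val_injective.injOn).subset ?_
    intro x hx
    change ‖a x‖ ≤ 0
    rw [← ht, show t x = 1 from hx, toAdd_one, norm_zero]
  -- The action need not be faithful, so translations commute only up to the finite kernel of `t`.
  -- Two of the commutators of `g ^ i` with `k` agree, so a nonzero power of `g` commutes with `k`.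
  obtain ⟨i, -, j, -, hij, hc⟩ := Set.infinite_univ.exists_ne_map_eq_of_mapsTo (β := T)
    (f := fun i : ℤ => g ^ i * k * (g ^ i)⁻¹ * k⁻¹) (t := {x : T | t x = 1})
    (fun i _ => by simp [mul_comm]) hker
  have hcomm : Commute (g ^ (i - j)) k := by
    have h1 : g ^ i * k * (g ^ i)⁻¹ = g ^ j * k * (g ^ j)⁻¹ := mul_right_cancel hc
    rw [Commute, SemiconjBy, sub_eq_neg_add, zpow_add, zpow_neg]
    have h2 : g ^ i * k = g ^ j * k * (g ^ j)⁻¹ * g ^ i := by rw [← h1]; group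
    rw [mul_assoc, h2]
    have h3 : (g ^ j)⁻¹ * g ^ i = g ^ i * (g ^ j)⁻¹ := by
      rw [← zpow_neg, ← zpow_add, ← zpow_add, add_comm]
    simp only [mul_assoc, inv_mul_cancel_left]
  set x := g ^ (i - j) with hx
  refine ⟨T.subtype.comp (MonoidHom.mk' (fun p => x ^ p.toAdd.1 * k ^ p.toAdd.2) fun p q => ?_), ?_⟩
  · rw [toAdd_mul, Prod.fst_add, Prod.snd_add, zpow_add, zpow_add, mul_assoc, mul_assoc,
      ← mul_assoc (x ^ q.toAdd.1), ← mul_assoc (k ^ p.toAdd.2),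
      (hcomm.zpow_zpow q.toAdd.1 p.toAdd.2).eq]
  · rw [MonoidHom.coe_comp]
    refine T.subtype_injective.comp ((injective_iff_map_eq_one _).2 fun p hp => ?_)
    have h1 : x ^ p.toAdd.1 * k ^ p.toAdd.2 = 1 := hp
    have h2 := congrArg (fun y => (t y).toAdd) h1
    simp only [hx, map_mul, map_zpow, map_one, toAdd_mul, toAdd_zpow, toAdd_one] at h2
    rw [smul_smul, ← Int.cast_smul_eq_zsmul ℝ, ← Int.cast_smul_eq_zsmul ℝ] at h2
    obtain ⟨h3, h4⟩ := hind _ _ h2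
    have h5 : p.toAdd.1 * (i - j) = 0 := by exact_mod_cast h3
    have h6 : p.toAdd.2 = 0 := by exact_mod_cast h4
    have h7 : p.toAdd.1 = 0 := (mul_eq_zero.1 h5).resolve_right (sub_ne_zero.2 hij)
    exact Multiplicative.toAdd.injective (Prod.ext h7 h6)

end IsCrystallographic

/-! ### Isolated flats and their stabilisers -/

/-- Only finitely many of the isolated flats meet a given compact set. -/
theorem finite_flats_inter {X : Type*} [MetricSpace X] [ProperSpace X] {𝓕 : Set (Set X)}
    (hF : ∀ F ∈ 𝓕, IsFlat F) {r : NNReal}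
    (hr : ∀ F₁ ∈ 𝓕, ∀ F₂ ∈ 𝓕, F₁ ≠ F₂ →
      Metric.ediam (Metric.thickening 1 F₁ ∩ Metric.thickening 1 F₂) ≤ r)
    {K : Set X} (hK : IsCompact K) : {F ∈ 𝓕 | (F ∩ K).Nonempty}.Finite := by
  rcases isEmpty_or_nonempty X with hX | hX
  · exact Set.finite_empty.subset fun F hF => hX.elim hF.2.some
  -- A pair in `F` at distance `r + 1` witnesses too large a diameter as soon as a second flat
  -- passes within `1` of both points.
  have hex : ∀ F ∈ {F ∈ 𝓕 | (F ∩ K).Nonempty}, ∃ x y : X,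
      x ∈ F ∧ y ∈ F ∧ x ∈ K ∧ dist x y = r + 1 := by
    rintro F ⟨hF', x, hxF, hxK⟩
    obtain ⟨k, hk, f, hf, rfl⟩ := hF F hF'
    obtain ⟨w, rfl⟩ := hxF
    refine ⟨f w, f (w + EuclideanSpace.single ⟨0, by omega⟩ ((r : ℝ) + 1)),
      ⟨w, rfl⟩, ⟨_, rfl⟩, hxK, ?_⟩
    rw [hf.dist_eq, dist_self_add_right, PiLp.norm_single, Real.norm_of_nonneg]
    positivity
  choose! x y hxy using hex
  by_contra hinf
  obtain ⟨t, -, ht, hcov⟩ := (hK.prod (hK.cthickening (r := (r : ℝ) + 1))).finite_cover_balls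
    (e := 1 / 2) (by norm_num)
  have hmem : ∀ F ∈ {F ∈ 𝓕 | (F ∩ K).Nonempty}, ∃ z ∈ t, dist (x F, y F) z < 1 / 2 := by
    intro F hFm
    obtain ⟨-, -, h1, h2⟩ := hxy F hFm
    have : (x F, y F) ∈ K ×ˢ Metric.cthickening ((r : ℝ) + 1) K :=
      ⟨h1, Metric.mem_cthickening_of_dist_le _ (x F) _ _ h1 (by rw [dist_comm, h2])⟩
    obtain ⟨z, hz, hz'⟩ := Set.mem_iUnion₂.1 (hcov this)
    exact ⟨z, hz, hz'⟩
  choose! z hz hz' using hmem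
  obtain ⟨F, hFm, F', hFm', hne, heq⟩ :=
    Set.Infinite.exists_ne_map_eq_of_mapsTo hinf hz ht
  have hd : dist (x F, y F) (x F', y F') < 1 := by
    have h1 := hz' F hFm
    have h2 := hz' F' hFm'
    rw [← heq] at h2
    have := dist_triangle_right (x F, y F) (x F', y F') (z F)
    linarith
  obtain ⟨h1, h2⟩ := max_lt_iff.1 hd
  obtain ⟨a1, a2, -, a3⟩ := hxy F hFm
  obtain ⟨b1, b2, -, -⟩ := hxy F' hFm'
  have hx : x F ∈ Metric.thickening 1 F ∩ Metric.thickening 1 F' :=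
    ⟨Metric.self_subset_thickening one_pos _ a1, Metric.mem_thickening_iff.2 ⟨_, b1, h1⟩⟩
  have hy : y F ∈ Metric.thickening 1 F ∩ Metric.thickening 1 F' :=
    ⟨Metric.self_subset_thickening one_pos _ a2, Metric.mem_thickening_iff.2 ⟨_, b2, h2⟩⟩
  have := (Metric.edist_le_ediam_of_mem hx hy).trans (hr F hFm.1 F' hFm'.1 hne)
  rw [edist_dist, a3, ENNReal.ofReal_le_iff_le_toReal ENNReal.coe_ne_top,
    ENNReal.coe_toReal] at this
  linarith

namespace IsGeometricAction

variable {G X : Type*} [Group G] [MetricSpace X] [MulAction G X]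

/-- The stabiliser of an isolated flat is cocompact on it. -/
theorem exists_isCompact_stabilizer (hG : IsGeometricAction G X) {𝓕 : Set (Set X)}
    (hfin : ∀ K : Set X, IsCompact K → {F ∈ 𝓕 | (F ∩ K).Nonempty}.Finite)
    (hinv : ∀ (g : G), ∀ F ∈ 𝓕, g • F ∈ 𝓕) {F₀ : Set X} (hF₀ : F₀ ∈ 𝓕) :
    ∃ L : Set X, IsCompact L ∧
      ∀ x ∈ F₀, ∃ g ∈ MulAction.stabilizer G F₀, ∃ y ∈ L, g • y = x := by
  have := hG.isIsometricSMul
  obtain ⟨K, hK, hcov⟩ := hG.cocompact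
  have hex : ∀ F : Set X, ∃ k : G, (∃ g : G, g • F₀ = F) → k • F₀ = F := by
    intro F
    by_cases h : ∃ g : G, g • F₀ = F
    · exact ⟨h.choose, fun _ => h.choose_spec⟩
    · exact ⟨1, fun h' => absurd h' h⟩
  choose k hk using hex
  -- For each of the finitely many translates of `F₀` meeting `K`, one fixed group element brings it
  -- back to `F₀` together with its part in `K`.
  refine ⟨⋃ F ∈ {F ∈ 𝓕 | (F ∩ K).Nonempty}, (k F)⁻¹ • K,
    (hfin K hK).isCompact_biUnion fun F _ => hK.smul _, fun x hx => ?_⟩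
  obtain ⟨g, y, hy, rfl⟩ := hcov x
  have hyF : y ∈ g⁻¹ • F₀ := Set.mem_inv_smul_set_iff.2 hx
  have hkF := hk (g⁻¹ • F₀) ⟨g⁻¹, rfl⟩
  refine ⟨g * k (g⁻¹ • F₀), ?_, (k (g⁻¹ • F₀))⁻¹ • y, ?_, ?_⟩
  · rw [MulAction.mem_stabilizer_iff, mul_smul, hkF, smul_inv_smul]
  · exact Set.mem_biUnion (x := g⁻¹ • F₀) ⟨hinv _ _ hF₀, y, hyF, hy⟩ (Set.smul_mem_smul_set hy)
  · rw [mul_smul, smul_inv_smul]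

/-- A group that acts geometrically and whose stabiliser of some flat is cocompact on that flat
contains `ℤ × ℤ`. -/
theorem exists_injective_of_isFlat [ProperSpace X] (hG : IsGeometricAction G X) {F₀ L : Set X}
    (hF : IsFlat F₀) (hL : IsCompact L)
    (hcov : ∀ x ∈ F₀, ∃ g ∈ MulAction.stabilizer G F₀, ∃ y ∈ L, g • y = x) :
    ∃ φ : Multiplicative (ℤ × ℤ) →* G, Function.Injective φ := by
  have := hG.isIsometricSMul
  obtain ⟨k, hk, f, hf, rfl⟩ := hF
  have hex : ∀ (g : MulAction.stabilizer G (Set.range f)) (w), ∃ w', f w' = (g : G) • f w := by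
    intro g w
    have h1 : (g : G) • f w ∈ (g : G) • Set.range f := Set.smul_mem_smul_set ⟨w, rfl⟩
    rwa [MulAction.mem_stabilizer_iff.1 g.2] at h1
  choose T hT using hex
  have hTmul : ∀ g h w, T (g * h) w = T g (T h w) := fun g h w => hf.injective (by
    rw [hT, hT, hT, Subgroup.coe_mul, mul_smul])
  have hTone : ∀ w, T 1 w = w := fun w => hf.injective (by
    rw [hT, Subgroup.coe_one, one_smul])
  have hTiso : ∀ g, Isometry (T g) := fun g => Isometry.of_dist_eq fun v w => by
    rw [← hf.dist_eq, hT, hT, dist_smul, hf.dist_eq]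
  let e : MulAction.stabilizer G (Set.range f) →
      EuclideanSpace ℝ (Fin k) ≃ᵢ EuclideanSpace ℝ (Fin k) := fun g =>
    ⟨⟨T g, T g⁻¹, fun w => by rw [← hTmul, inv_mul_cancel, hTone],
      fun w => by rw [← hTmul, mul_inv_cancel, hTone]⟩, hTiso g⟩
  let A : MulAction.stabilizer G (Set.range f) →
      EuclideanSpace ℝ (Fin k) →L[ℝ] EuclideanSpace ℝ (Fin k) := fun g =>
    ((e g).toRealLinearIsometryEquiv : _ →L[ℝ] _)
  have hA : ∀ g w, A g w = T g w - T g 0 := fun g w =>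
    (e g).toRealLinearIsometryEquiv_apply w
  have hcryst : IsCrystallographic A fun g => T g 0 := by
    refine ⟨fun g h => ?_, ?_, fun g x => (e g).toRealLinearIsometryEquiv.norm_map x,
      fun g h => ?_, fun R => ?_, ?_⟩
    · ext1 w
      change _ = A g (A h w)
      rw [hA h, map_sub, hA, hA, hA, hTmul, hTmul]
      abel
    · ext1 w
      rw [hA, hTone, hTone, sub_zero]
      rfl
    · rw [hA, hTmul]
      abel
    · refine ((hG.finite_smul_inter (isCompact_singleton (x := f 0))
        (isCompact_closedBall (f 0) R)).preimage
          (f := ((↑) : MulAction.stabilizer G (Set.range f) → G))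
          Subtype.val_injective.injOn).subset ?_
      intro g hg
      refine ⟨f 0, rfl, ?_⟩
      rw [Metric.mem_closedBall, ← hT, hf.dist_eq, dist_zero_right]
      exact hg
    · obtain ⟨R, hR⟩ := hL.isBounded.subset_closedBall (f 0)
      refine ⟨R, fun w => ?_⟩
      obtain ⟨g, hg, y, hy, hgy⟩ := hcov (f w) ⟨w, rfl⟩
      refine ⟨⟨g, hg⟩, ?_⟩
      rw [← dist_eq_norm, ← hf.dist_eq, hT, ← hgy, dist_smul, dist_comm]
      exact hR hy
  obtain ⟨φ, hφ⟩ := hcryst.exists_injective (by simpa using hk)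
  exact ⟨(Subgroup.subtype _).comp φ, (Subgroup.subtype_injective _).comp hφ⟩

end IsGeometricAction

/-! ### Change of universe and conclusion -/

/-- Word hyperbolicity of a group acting geometrically on a proper hyperbolic space, which may
live in any universe. -/
theorem IsGeometricAction.isWordHyperbolic {G X : Type*} [Group G] [MetricSpace X] [Nonempty X]
    [MulAction G X] [ProperSpace X] (hG : IsGeometricAction G X) (hX : IsHyperbolicSpace X) :
    IsWordHyperbolic G := by
  -- A point is determined by its distances to a dense sequence.
  have hsmall : Small.{0} X := by
    refine small_of_injective (β := ℕ → ℝ)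
      (f := fun x n => dist x (TopologicalSpace.denseSeq X n)) fun x y hxy => ?_
    have h1 : (fun z => dist x z) = fun z => dist y z :=
      Continuous.ext_on (TopologicalSpace.denseRange_denseSeq X) (by fun_prop) (by fun_prop)
        (by rintro _ ⟨n, rfl⟩; exact congrFun hxy n)
    have h2 := congrFun h1 x
    simp only [dist_self] at h2
    exact (dist_eq_zero.1 h2.symm).symm
  let e := equivShrink.{0} X
  let : MetricSpace (Shrink.{0} X) := MetricSpace.induced e.symm e.symm.injective inferInstance
  let i : Shrink.{0} X ≃ᵢ X := ⟨e.symm, Isometry.of_dist_eq fun _ _ => rfl⟩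
  let : MulAction G (Shrink.{0} X) :=
    { smul := fun g x => e (g • e.symm x)
      one_smul := fun x => by
        change e ((1 : G) • e.symm x) = x
        simp
      mul_smul := fun g h x => by
        change e ((g * h) • e.symm x) = e (g • e.symm (e (h • e.symm x)))
        simp [mul_smul] }
  have hsmul : ∀ (g : G) (x : Shrink.{0} X), i (g • x) = g • i x := fun g x =>
    e.symm_apply_apply _
  have hgeo : ∀ {γ : ℝ → Shrink.{0} X} {x y : Shrink.{0} X}, IsGeodesicSegment γ x y →
      IsGeodesicSegment (fun t => i (γ t)) (i x) (i y) := by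
    intro γ x y h
    refine ⟨by rw [h.source], by rw [i.dist_eq, h.target], fun s hs t ht => ?_⟩
    rw [i.dist_eq] at hs ht ⊢
    exact h.isometric s hs t ht
  refine ⟨Shrink.{0} X, inferInstance, inferInstance, ⟨e (Classical.arbitrary X)⟩, ⟨fun x y => ?_, ?_⟩,
    ⟨fun g => ?_, ⟨fun {K L} hK hL => ?_⟩, ?_⟩⟩
  · obtain ⟨γ, hγ⟩ := hX.1 (i x) (i y)
    refine ⟨fun t => i.symm (γ t), ?_, ?_, fun s hs t ht => ?_⟩
    · rw [hγ.source, i.symm_apply_apply]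
    · rw [← i.dist_eq, hγ.target, i.symm_apply_apply]
    · rw [← i.dist_eq] at hs ht
      rw [i.symm.dist_eq]
      exact hγ.isometric s hs t ht
  · obtain ⟨δ, hδ⟩ := hX.2
    refine ⟨δ, fun p q r α β γ hα hβ hγ x hx => ?_⟩
    obtain ⟨t, ht, rfl⟩ := hx
    obtain ⟨y, hy, hxy⟩ := hδ _ _ _ _ _ _ (hgeo hα) (hgeo hβ) (hgeo hγ) (i (α t))
      ⟨t, by rwa [i.dist_eq], rfl⟩
    rcases hy with ⟨s, hs, rfl⟩ | ⟨s, hs, rfl⟩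
    · rw [i.dist_eq] at hs hxy
      exact ⟨β s, Or.inl ⟨s, hs, rfl⟩, hxy⟩
    · rw [i.dist_eq] at hs hxy
      exact ⟨γ s, Or.inr ⟨s, hs, rfl⟩, hxy⟩
  · refine Isometry.of_dist_eq fun x y => ?_
    rw [← i.dist_eq, hsmul, hsmul, (hG.isometric g).dist_eq, i.dist_eq]
  · refine (hG.finite_smul_inter (hK.image i.continuous) (hL.image i.continuous)).subset ?_
    rintro g ⟨_, ⟨x, hx, rfl⟩, hgx⟩
    exact ⟨i x, ⟨x, hx, rfl⟩, g • x, hgx, hsmul g x⟩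
  · obtain ⟨K, hK, hcov⟩ := hG.cocompact
    refine ⟨i.symm '' K, hK.image i.symm.continuous, fun x => ?_⟩
    obtain ⟨g, y, hy, hgy⟩ := hcov (i x)
    refine ⟨g, i.symm y, ⟨y, hy, rfl⟩, i.injective ?_⟩
    rw [hsmul, i.apply_symm_apply, hgy]

theorem mainTheorem5 {G X : Type*} [Group G] [MetricSpace X] [Nonempty X] [MulAction G X]
    (hX : IsCAT0 X) (hflats : HasIsolatedFlats X) (hG : IsGeometricAction G X) :
    IsWordHyperbolic G ∨ ∃ H : Subgroup G, Nonempty (H ≃* Multiplicative (ℤ × ℤ)) := by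
  have := hG.properSpace hX.geodesic
  have := hG.isIsometricSMul
  by_cases hh : IsHyperbolicSpace X
  · exact Or.inl (hG.isWordHyperbolic hh)
  obtain ⟨𝓕, hF, ⟨B, hB⟩, ⟨ψ, hψ⟩, hinv⟩ := hflats
  obtain ⟨F, hFflat⟩ := hG.exists_isFlat hX hh
  -- Maximality serves to show that the isolated family is nonempty.
  obtain ⟨F₀, hF₀, -⟩ := hB F hFflat
  obtain ⟨L, hL, hcov⟩ := hG.exists_isCompact_stabilizer
    (fun K hK => finite_flats_inter hF
      (fun F₁ h₁ F₂ h₂ hne => by simpa using hψ F₁ h₁ F₂ h₂ hne 1) hK)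
    (fun g F hF => hinv (IsometryEquiv.constSMul g) F hF) hF₀
  obtain ⟨φ, hφ⟩ := hG.exists_injective_of_isFlat (hF F₀ hF₀) hL hcov
  exact Or.inr ⟨φ.range, ⟨(MonoidHom.ofInjective hφ).symm⟩⟩
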